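/- Let $D>3$ be even and $S=\{1,\dots,2D\}$. Let $\square_{2D}$ be the folded $2D$-cube: its vertex set $X$ consists of the unordered pairs $x=\{x_1,x_2\}$ of complementary subsets of $S$, labelled so that $|x_1|\le|x_2|$, and $x,y$ are adjacent iff $\min_{a,b\in\{1,2\}}|x_a\triangle y_b|=1$. Let $\partial$ be the path-length distance, $\mathbf 0=\{\emptyset,S\}$, and let $T\subseteq\mathrm{Mat}_X(\mathbb C)$ be the Terwilliger algebra with respect to $\mathbf 0$, that is, the algebra generated by the distance matrices $A_i$ ($(A_i)_{xy}=1$ if $\partial(x,y)=i$, else $0$) and the dual idempotents $E_i^*$ (diagonal, $(E_i^*)_{yy}=1$ if $\partial(\mathbf 0,y)=i$, else $0$), $0\le i\le D$. Let $M^t_{i,j}\in\mathrm{Mat}_X(\mathbb C)$ be the $0/1$ matrix whose $(x,y)$-entry is $1$ iff $\partial(\mathbf 0,x)=i$, $\partial(\mathbf 0,y)=j$ and $t=\max|u\cap v|$, the maximum over $u\in\{x_1,x_2\}$ with $|u|=i$ and $v\in\{y_1,y_2\}$ with $|v|=j$. Give $V=\mathbb C^X$ its standard Hermitian inner product and for $0\le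 r\le D$ put $$\mathcal L_r=\{\xi\in V:\ M^{r-1}_{r-1,r}\xi=0,\ \ \xi_x=0\text{ whenever }|x_1|\ne r\}$$ (the first condition being void for $r=0$). Let $N_r=\{r,\dots,D\}$ for even $r$ and $N_r=\{r,\dots,D-1\}$ for odd $r$. For $\xi\in\mathcal L_r$ and $i\in N_r$ put $$u_{r,\xi,i}=\tbinom{2D-2r}{i-r}^{-1/2}M^r_{i,r}\xi\quad(r\le i\le D-1),\qquad u_{r,\xi,D}=\tfrac{\sqrt2}{2}\tbinom{2D-2r}{D-r}^{-1/2}M^r_{D,r}\xi\quad(0<r<D,\ r\text{ even}),$$ $$u_{0,\xi,D}=\sqrt2\,\tbinom{2D}{D}^{-1/2}M^0_{D,0}\xi,\qquad u_{D,\xi,D}=\xi .$$ For any choice of orthonormal bases $B_r$ of $\mathcal L_r$ $(0\le r\le D)$, let $U_1$ be the matrix whose columns are the vectors $u_{r,\xi,i}$ with $0\le r\le D$, $\xi\in B_r$, $i\in N_r$. Then $U_1$ is a (square) unitary matrix, i.e. $U_1^{*}U_1=I$ and $U_1U_1^{*}=I$, and it block-diagonalizes $T$: there is an isomorphism of $\mathbb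 C$-algebras $$\Phi=(\Phi_r)_r:\ T\ \xrightarrow{\ \cong\ }\ \bigoplus_{r=0}^{D}\mathbb C^{N_r\times N_r},$$ not depending on the choice of the bases, such that for all $A\in T$ $$(U_1^{*}AU_1)_{(r,\xi,i),(r',\xi',j)}=\begin{cases}\Phi_r(A)_{i,j}&\text{if }r=r',\ \xi=\xi',\\0&\text{otherwise.}\end{cases}$$ In other words, $U_1^{*}AU_1$ is block diagonal with $|B_r|$ equal copies of the block $\Phi_r(A)$ for each $r$. In particular $T\cong\bigoplus_{r=0}^{D}\mathbb C^{N_r\times N_r}$. -/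

import Mathlib

open scoped Matrix Kronecker

noncomputable section

namespace FoldedCube

/-! ### Terwilliger algebra of a graph with respect to a base vertex -/

/-- The `i`-th distance matrix of a graph (for the path-length distance). -/
def distanceMatrix {V : Type*} (G : SimpleGraph V) (i : ℕ) : Matrix V V ℂ :=
  Matrix.of fun x y => if G.dist x y = i then 1 else 0

/-- The `i`-th dual idempotent of a graph with respect to the vertex `x`. -/
def dualIdempotent {V : Type*} [DecidableEq V] (G : SimpleGraph V) (x : V) (i : ℕ) : Matrix V V ℂ :=
  Matrix.diagonal fun y => if G.dist x y = i then 1 else 0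

/-- The Terwilliger algebra of a finite connected graph with respect to the vertex `x`: the
unital subalgebra of the full matrix algebra generated by all distance matrices and all dual
idempotents (those whose index exceeds the diameter are zero). -/
def terwilligerAlgebra {V : Type*} [Fintype V] [DecidableEq V] (G : SimpleGraph V) (x : V) :
    Subalgebra ℂ (Matrix V V ℂ) :=
  Algebra.adjoin ℂ (Set.range (distanceMatrix G) ∪ Set.range (dualIdempotent G x))

/-! ### The folded cube -/

/-- Vertices of the folded `n`-cube: unordered pairs `{u, uᶜ}` of complementary subsets of an
`n`-element set. -/
abbrev Vertex (n : ℕ) : Type :=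
  {p : Sym2 (Finset (Fin n)) // ∃ u : Finset (Fin n), p = s(u, uᶜ)}

/-- The folded `n`-cube: `z` and `w` are adjacent when the minimum of `|u ∆ v|`, over the parts
`u` of `z` and `v` of `w`, equals `1`. -/
def graph (n : ℕ) : SimpleGraph (Vertex n) where
  Adj z w := IsLeast {m : ℕ | ∃ u ∈ z.1, ∃ v ∈ w.1, m = (symmDiff u v).card} 1
  symm := ⟨by
    intro z w h
    have e : {m : ℕ | ∃ u ∈ w.1, ∃ v ∈ z.1, m = (symmDiff u v).card} =
        {m : ℕ | ∃ u ∈ z.1, ∃ v ∈ w.1, m = (symmDiff u v).card} := by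
      ext m
      constructor
      · rintro ⟨u, hu, v, hv, rfl⟩
        exact ⟨v, hv, u, hu, by rw [symmDiff_comm]⟩
      · rintro ⟨u, hu, v, hv, rfl⟩
        exact ⟨v, hv, u, hu, by rw [symmDiff_comm]⟩
    rw [e]
    exact h⟩
  loopless := ⟨by
    rintro ⟨_, u, rfl⟩ h
    have h0 := h.2 ⟨u, Sym2.mem_mk_left u uᶜ, u, Sym2.mem_mk_left u uᶜ, rfl⟩
    simp at h0⟩

/-- The base vertex `{∅, S}`. -/
def origin (n : ℕ) : Vertex n := ⟨s(∅, ∅ᶜ), ∅, rfl⟩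

/-! ### The even case `n = 2 * D` -/

/-- The pair `(x, y)` has type `(i, j, t)` with respect to the base vertex: `x` and `y` lie at
distance `i` and `j` from it, and `t` is the largest `|u ∩ v|` for parts `u` of `x` and `v` of `y`
with `|u| = i` and `|v| = j`. A vertex at distance `i < D` has exactly one part of size `i`; for
`i = D` both of its parts have size `D`. -/
def HasType (D i j t : ℕ) (x y : Vertex (2 * D)) : Prop :=
  (graph (2 * D)).dist (origin (2 * D)) x = i ∧
  (graph (2 * D)).dist (origin (2 * D)) y = j ∧
  IsGreatest {m : ℕ | ∃ u ∈ x.1, ∃ v ∈ y.1, u.card = i ∧ v.card = j ∧ m = (u ∩ v).card} t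

open Classical in
/-- The zero-one matrix `M^t_{i,j}`. -/
def orbitMatrix (D i j t : ℕ) : Matrix (Vertex (2 * D)) (Vertex (2 * D)) ℂ :=
  Matrix.of fun x y => if HasType D i j t x y then 1 else 0

/-- The space `L_r` (for `r ≤ D`) inside the Hermitian space of complex functions on the vertices:
vectors supported on the vertices having a part of size `r` and killed by `M^{r-1}_{r-1,r}`
(no second condition for `r = 0`). -/
def lowestSpace (D r : ℕ) : Submodule ℂ (EuclideanSpace ℂ (Vertex (2 * D))) where
  carrier := {ξ | (∀ s : ℕ, r = s + 1 → orbitMatrix D s r s *ᵥ ξ.ofLp = 0) ∧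
    ∀ x : Vertex (2 * D), (∀ u ∈ x.1, u.card ≠ r) → ξ x = 0}
  zero_mem' := by simp
  add_mem' := by
    rintro a b ⟨ha, ha'⟩ ⟨hb, hb'⟩
    refine ⟨fun s hs => ?_, fun x hx => ?_⟩
    · simp [Matrix.mulVec_add, ha s hs, hb s hs]
    · simp [ha' x hx, hb' x hx]
  smul_mem' := by
    rintro c a ⟨ha, ha'⟩
    refine ⟨fun s hs => ?_, fun x hx => ?_⟩
    · simp [Matrix.mulVec_smul, ha s hs]
    · simp [ha' x hx]

/-- The vector `u_{r,ξ,i}`, a multiple of `M^r_{i,r} ξ`. -/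
def basisVector (D r i : ℕ) (ξ : Vertex (2 * D) → ℂ) : Vertex (2 * D) → ℂ :=
  if i < D then
    (((√((2 * D - 2 * r).choose (i - r) : ℝ))⁻¹ : ℝ) : ℂ) • (orbitMatrix D i r r *ᵥ ξ)
  else if r = D then ξ
  else if r = 0 then
    ((√2 * (√((2 * D).choose D : ℝ))⁻¹ : ℝ) : ℂ) • (orbitMatrix D D 0 0 *ᵥ ξ)
  else
    ((√2 / 2 * (√((2 * D - 2 * r).choose (D - r) : ℝ))⁻¹ : ℝ) : ℂ) •
      (orbitMatrix D D r r *ᵥ ξ)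

/-- `N_r = {r, …, D}` for even `r`, and `N_r = {r, …, D - 1}` for odd `r`. -/
def levels (D r : ℕ) : Finset ℕ :=
  if Even r then Finset.Icc r D else Finset.Icc r (D - 1)

/-- The matrix `U₁`: its columns are the vectors `u_{r,ξ,i}`, indexed by `r ∈ {0, …, D}`, by the
members `ξ` of a chosen orthonormal basis of `L_r`, and by `i ∈ N_r`. -/
def transition (D : ℕ) {ι : Fin (D + 1) → Type*} [∀ r, Fintype (ι r)]
    (b : ∀ r : Fin (D + 1), OrthonormalBasis (ι r) ℂ (lowestSpace D r)) :
    Matrix (Vertex (2 * D)) (Σ r : Fin (D + 1), ι r × levels D r) ℂ :=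
  Matrix.of fun x p =>
    basisVector D p.1 p.2.2 (b p.1 p.2.1 : EuclideanSpace ℂ (Vertex (2 * D))).ofLp x

end FoldedCube

end

/-! Below the middle, vertices at distance `i < D` from the origin are the `i`-subsets of `S`; at
distance `D` they are pairs of complementary `D`-subsets. Cutting `A_1` along the levels gives
raising and lowering matrices, adjoint to each other. `L_r` is the part of level `r` killed by
lowering, and each `ξ` in it generates a string of vectors `w_i` (`weight`), where `w_i(u)` is the
sum of `ξ` over the `r`-subsets of `u`. Raising `w_i` is a double count; lowering it rests on `w(uᶜ)
= (-1)^r w(u)` (`IsLowest.subsetSum_compl`). The same identity explains `N_r`: at level `D` the sets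
`u` and `uᶜ` are one vertex, so for even `r` the string reaches `D`, while for odd `r` the
contributions of the two parts cancel and it stops at `D - 1`.

Adjointness gives a recursion for inner products along the strings, hence orthogonality and the
norms. A vector orthogonal to all strings vanishes level by level, because its lowering is again
orthogonal to all strings. So `U_1` is unitary.

`T` is generated by `A_1` and the dual idempotents, which act on strings with coefficients
independent of `ξ`; thus each element of `T` acts by one block per `r` (`exists_actsBy`).
Conversely, matrix units for the strings are built inside `T` by induction on `r`
(`exists_isMatrixUnit_self`). Unitarity makes the element unique for given blocks, and `L_r ≠ 0`
makes the blocks unique for a given element. -/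

noncomputable section
namespace FoldedCube

open Finset

/-! ### Sums over the `r`-subsets of a set -/

section SubsetSum

variable {α : Type*}

/-- The sum of `f` over the `r`-element subsets of `u`. -/
def subsetSum (r : ℕ) (f : Finset α → ℂ) (u : Finset α) : ℂ :=
  ∑ v ∈ u.powersetCard r, f v

theorem subsetSum_of_card_lt {r : ℕ} (f : Finset α → ℂ) {u : Finset α} (h : u.card < r) :
    subsetSum r f u = 0 := by
  simp [subsetSum, powersetCard_eq_empty.2 h]

theorem subsetSum_of_card_eq {r : ℕ} (f : Finset α → ℂ) {u : Finset α} (h : u.card = r) :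
    subsetSum r f u = f u := by
  subst h
  simp [subsetSum]

variable [DecidableEq α]

/-- Double count: an `r`-subset `v` of `u` survives the deletion of `a` exactly for the `|u| - r`
elements `a` outside `v`. -/
theorem sum_subsetSum_erase (r : ℕ) (f : Finset α → ℂ) (u : Finset α) :
    ∑ a ∈ u, subsetSum r f (u.erase a) = ((u.card : ℂ) - r) * subsetSum r f u := by
  unfold subsetSum
  rw [sum_comm' (t' := u.powersetCard r) (s' := fun v => u \ v), mul_sum]
  · refine sum_congr rfl fun v hv => ?_
    rw [mem_powersetCard] at hv
    rw [sum_const, card_sdiff_of_subset hv.1, hv.2, nsmul_eq_mul,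
      Nat.cast_sub (hv.2 ▸ card_le_card hv.1)]
  · intro a v
    simp only [mem_powersetCard, mem_sdiff, subset_erase]
    tauto

variable [Fintype α]

/-- The function `f` is annihilated by the lowering map from `r`-subsets to `(r-1)`-subsets. -/
def IsLowest (r : ℕ) (f : Finset α → ℂ) : Prop :=
  ∀ v : Finset α, v.card + 1 = r → ∑ a ∈ vᶜ, f (insert a v) = 0

theorem sum_sum_insert (s k : ℕ) (f : Finset α → ℂ) (u : Finset α) :
    ∑ w ∈ univ.powersetCard s with (w ∩ u).card = k, ∑ a ∈ wᶜ, f (insert a w) =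
      ∑ v ∈ univ.powersetCard (s + 1), ∑ a ∈ v with (v.erase a ∩ u).card = k, f v := by
  rw [sum_sigma', sum_sigma']
  refine sum_bij' (fun p _ => ⟨insert p.2 p.1, p.2⟩) (fun p _ => ⟨p.1.erase p.2, p.2⟩)
    ?_ ?_ ?_ ?_ ?_
  · rintro ⟨w, a⟩ h
    simp only [mem_sigma, mem_filter, mem_powersetCard, mem_compl, subset_univ, true_and] at h ⊢
    simp [h.2, h.1.1, h.1.2]
  · rintro ⟨v, a⟩ h
    simp only [mem_sigma, mem_filter, mem_powersetCard, mem_compl, subset_univ, true_and] at h ⊢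
    exact ⟨⟨by simp [card_erase_of_mem h.2.1, h.1], h.2.2⟩, by simp⟩
  · rintro ⟨w, a⟩ h
    simp only [mem_sigma, mem_compl] at h
    simp [erase_insert h.2]
  · rintro ⟨v, a⟩ h
    simp only [mem_sigma, mem_filter] at h
    simp [insert_erase h.2.1]
  · intros; rfl

-- Deleting an element of `v ∩ u` lowers the size of the intersection by one; deleting an element of
-- `v \ u` preserves it.
omit [Fintype α] in
theorem sum_filter_card_erase_inter (k : ℕ) (c : ℂ) (u v : Finset α) :
    ∑ a ∈ v with (v.erase a ∩ u).card = k, c =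
      (if (v ∩ u).card = k + 1 then (k + 1 : ℂ) * c else 0) +
        if (v ∩ u).card = k then ((v.card : ℂ) - k) * c else 0 := by
  rw [sum_filter, ← sum_inter_add_sum_sdiff v u]
  congr 1
  · have : ∀ a ∈ v ∩ u, (if (v.erase a ∩ u).card = k then c else 0) =
        if (v ∩ u).card = k + 1 then c else 0 := by
      intro a ha
      have := card_pos.2 ⟨a, ha⟩
      rw [erase_inter, card_erase_of_mem ha]
      congr 1
      rw [eq_iff_iff]
      omega
    rw [sum_congr rfl this, sum_const, nsmul_eq_mul]
    split_ifs with h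
    · rw [h]; push_cast; ring
    · simp
  · have : ∀ a ∈ v \ u, (if (v.erase a ∩ u).card = k then c else 0) =
        if (v ∩ u).card = k then c else 0 := by
      intro a ha
      rw [mem_sdiff] at ha
      rw [erase_inter, erase_eq_of_notMem (by simp [ha.2])]
    rw [sum_congr rfl this, sum_const, nsmul_eq_mul]
    split_ifs with h
    · rw [← h, ← card_sdiff_add_card_inter v u]; push_cast; ring
    · simp

/-- Let `S_k` be the sum on the left. Adding up the lowest-vector equations over all `(r-1)`-sets
`w` with `|w ∩ u| = k` gives `(k+1) S_{k+1} + (r-k) S_k = 0`, and this recurrence is solved by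
signed binomial coefficients. -/
theorem IsLowest.sum_card_inter {r : ℕ} {f : Finset α → ℂ} (hf : IsLowest r f) (u : Finset α)
    {k : ℕ} (hk : k ≤ r) :
    ∑ v ∈ univ.powersetCard r with (v ∩ u).card = k, f v =
      (-1) ^ k * r.choose k * ∑ v ∈ univ.powersetCard r with (v ∩ u).card = 0, f v := by
  induction k with
  | zero => simp
  | succ k ih =>
    obtain ⟨s, rfl⟩ : ∃ s, r = s + 1 := ⟨r - 1, by omega⟩
    have h0 : ∑ w ∈ univ.powersetCard s with (w ∩ u).card = k, ∑ a ∈ wᶜ, f (insert a w) = 0 := by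
      refine sum_eq_zero fun w hw => hf w ?_
      rw [mem_filter, mem_powersetCard] at hw
      rw [hw.1.2]
    rw [sum_sum_insert] at h0
    simp_rw [sum_filter_card_erase_inter] at h0
    rw [sum_add_distrib, ← sum_filter, ← sum_filter, ← mul_sum] at h0
    have h1 : ∑ v ∈ (univ : Finset α).powersetCard (s + 1) with (v ∩ u).card = k,
        ((v.card : ℂ) - k) * f v = ((s + 1 : ℕ) - k : ℂ) *
          ∑ v ∈ univ.powersetCard (s + 1) with (v ∩ u).card = k, f v := by
      rw [mul_sum]
      refine sum_congr rfl fun v hv => ?_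
      rw [mem_filter, mem_powersetCard] at hv
      rw [hv.1.2]
    rw [h1, ih (by omega)] at h0
    have h2 : ((s + 1).choose (k + 1) : ℂ) * (k + 1) = (s + 1).choose k * ((s + 1 : ℕ) - k) := by
      have := Nat.choose_succ_right_eq (s + 1) k
      rw [← Nat.cast_sub (by omega : k ≤ s + 1)]
      exact_mod_cast this
    have h3 : (k + 1 : ℂ) ≠ 0 := by exact_mod_cast k.succ_ne_zero
    apply mul_left_cancel₀ h3
    rw [pow_succ]
    linear_combination h0 + (-1) ^ k *
      (∑ v ∈ univ.powersetCard (s + 1) with (v ∩ u).card = 0, f v) * h2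

/-- This is the extreme case `k = r`: meeting `u` in `r` elements means lying in `u`, meeting it in
none means lying in `uᶜ`. All parity conditions on `r` come from this sign. -/
theorem IsLowest.subsetSum_compl {r : ℕ} {f : Finset α → ℂ} (hf : IsLowest r f) (u : Finset α) :
    subsetSum r f uᶜ = (-1) ^ r * subsetSum r f u := by
  have h := hf.sum_card_inter u le_rfl
  have e1 : {v ∈ (univ : Finset α).powersetCard r | (v ∩ u).card = r} = u.powersetCard r := by
    ext v
    simp only [mem_filter, mem_powersetCard, subset_univ, true_and]
    constructor
    · rintro ⟨h1, h2⟩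
      have := eq_of_subset_of_card_le (inter_subset_left : v ∩ u ⊆ v) (by omega)
      exact ⟨by rw [← this]; exact inter_subset_right, h1⟩
    · rintro ⟨h1, h2⟩
      rw [inter_eq_left.2 h1]
      exact ⟨h2, h2⟩
  have e2 : {v ∈ (univ : Finset α).powersetCard r | (v ∩ u).card = 0} = uᶜ.powersetCard r := by
    ext v
    simp only [mem_filter, mem_powersetCard, subset_univ, true_and, card_eq_zero,
      ← disjoint_iff_inter_eq_empty, subset_compl_iff_disjoint_right]
    tauto
  rw [e1, e2, Nat.choose_self, Nat.cast_one, mul_one] at h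
  unfold subsetSum
  rw [h, ← mul_assoc, ← pow_add, ← two_mul, pow_mul]
  simp

/-- Inserting into `u` is erasing from `uᶜ`, so passing to complements twice reduces this to
`sum_subsetSum_erase`. -/
theorem IsLowest.sum_subsetSum_insert {r : ℕ} {f : Finset α → ℂ} (hf : IsLowest r f)
    (u : Finset α) :
    ∑ a ∈ uᶜ, subsetSum r f (insert a u) =
      ((Fintype.card α : ℂ) - u.card - r) * subsetSum r f u := by
  have h : ∀ a ∈ uᶜ, subsetSum r f (insert a u) = (-1) ^ r * subsetSum r f (uᶜ.erase a) := by
    intro a _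
    rw [← hf.subsetSum_compl, compl_erase, compl_compl]
  rw [sum_congr rfl h, ← mul_sum, sum_subsetSum_erase, hf.subsetSum_compl, card_compl,
    Nat.cast_sub (card_le_univ u), mul_left_comm, ← mul_assoc ((-1) ^ r), ← pow_add, ← two_mul,
    pow_mul]
  simp

end SubsetSum

/-! ### Vertices of the folded cube, adjacency and distance -/

section Vertices

variable {n : ℕ}

/-- The vertex `{u, uᶜ}`. -/
def mk (u : Finset (Fin n)) : Vertex n := ⟨s(u, uᶜ), u, rfl⟩

theorem mem_mk {u w : Finset (Fin n)} : w ∈ (mk u).1 ↔ w = u ∨ w = uᶜ := Sym2.mem_iff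

theorem mk_compl (u : Finset (Fin n)) : mk uᶜ = mk u :=
  Subtype.ext (by simp [mk, Sym2.eq_swap])

theorem mk_eq_mk {u v : Finset (Fin n)} : mk u = mk v ↔ u = v ∨ u = vᶜ := by
  constructor
  · intro h
    exact mem_mk.1 (h ▸ mem_mk.2 (Or.inl rfl))
  · rintro (rfl | rfl)
    · rfl
    · exact mk_compl v

theorem exists_mk (x : Vertex n) : ∃ u, x = mk u := by
  obtain ⟨_, u, rfl⟩ := x
  exact ⟨u, rfl⟩

theorem symmDiff_compl (u v : Finset (Fin n)) : symmDiff u vᶜ = (symmDiff u v)ᶜ := by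
  ext a
  simp only [mem_symmDiff, mem_compl]
  tauto

theorem compl_symmDiff (u v : Finset (Fin n)) : symmDiff uᶜ v = (symmDiff u v)ᶜ := by
  rw [symmDiff_comm, symmDiff_compl, symmDiff_comm]

theorem adj_mk {u v : Finset (Fin n)} :
    (graph n).Adj (mk u) (mk v) ↔ min (symmDiff u v).card (symmDiff u v)ᶜ.card = 1 := by
  have key : {m : ℕ | ∃ u' ∈ (mk u).1, ∃ v' ∈ (mk v).1, m = (symmDiff u' v').card} =
      {(symmDiff u v).card, (symmDiff u v)ᶜ.card} := by
    ext m
    simp only [mem_mk, exists_eq_or_imp, exists_eq_left, symmDiff_compl, compl_symmDiff,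
      compl_compl, Set.mem_ofPred_eq, Set.mem_insert_iff, Set.mem_singleton_iff]
    tauto
  have h : IsLeast {(symmDiff u v).card, (symmDiff u v)ᶜ.card}
      (min (symmDiff u v).card (symmDiff u v)ᶜ.card) := isLeast_pair
  change IsLeast _ 1 ↔ _
  rw [key]
  exact ⟨fun h' => h.unique h', fun e => e ▸ h⟩

theorem adj_mk_symmDiff_singleton (hn : 2 ≤ n) (u : Finset (Fin n)) (a : Fin n) :
    (graph n).Adj (mk u) (mk (symmDiff u {a})) := by
  rw [adj_mk, symmDiff_symmDiff_cancel_left, card_compl, card_singleton, Fintype.card_fin]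
  omega

theorem adj_mk_iff (hn : 2 ≤ n) {u : Finset (Fin n)} {y : Vertex n} :
    (graph n).Adj (mk u) y ↔ ∃ a, mk (symmDiff u {a}) = y := by
  constructor
  · obtain ⟨v, rfl⟩ := exists_mk y
    rw [adj_mk]
    intro h
    rcases min_choice (symmDiff u v).card (symmDiff u v)ᶜ.card with e | e <;> rw [e] at h
    · obtain ⟨a, ha⟩ := card_eq_one.1 h
      exact ⟨a, by rw [← ha, symmDiff_symmDiff_cancel_left]⟩
    · obtain ⟨a, ha⟩ := card_eq_one.1 h
      exact ⟨a, by rw [← ha, ← symmDiff_compl, symmDiff_symmDiff_cancel_left, mk_compl]⟩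
  · rintro ⟨a, rfl⟩
    exact adj_mk_symmDiff_singleton hn u a

theorem mk_symmDiff_singleton_injective (hn : 2 < n) (u : Finset (Fin n)) :
    Function.Injective fun a : Fin n => mk (symmDiff u {a}) := by
  intro a b h
  rcases mk_eq_mk.1 h with h | h
  · simpa using h
  · rw [← symmDiff_compl] at h
    have h := congrArg card (symmDiff_right_injective u h)
    rw [card_compl, card_singleton, card_singleton, Fintype.card_fin] at h
    omega

/-- Flipping the elements of `u ∆ v` one at a time is a walk. Reachability is carried along because
unreachable vertices have distance `0` by convention. -/
theorem dist_le_card (hn : 2 ≤ n) (u v : Finset (Fin n)) :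
    (graph n).Reachable (mk u) (mk v) ∧ (graph n).dist (mk u) (mk v) ≤ (symmDiff u v).card := by
  induction h : (symmDiff u v).card generalizing u with
  | zero =>
    rw [card_eq_zero, symmDiff_eq_empty] at h
    subst h
    exact ⟨SimpleGraph.Reachable.refl _, by simp⟩
  | succ k ih =>
    obtain ⟨a, ha⟩ := card_pos.1 (by omega : 0 < (symmDiff u v).card)
    have e : symmDiff (symmDiff u {a}) v = (symmDiff u v).erase a := by
      rw [symmDiff_right_comm, symmDiff_of_ge (singleton_subset_iff.2 ha), sdiff_singleton_eq_erase]
    obtain ⟨h1, h2⟩ := ih (symmDiff u {a}) (by rw [e, card_erase_of_mem ha]; omega)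
    have hadj := adj_mk_symmDiff_singleton hn u a
    refine ⟨hadj.reachable.trans h1, ?_⟩
    obtain ⟨p, hp⟩ := h1.exists_walk_length_eq_dist
    have := SimpleGraph.dist_le (SimpleGraph.Walk.cons hadj p)
    rw [SimpleGraph.Walk.length_cons] at this
    omega

theorem card_symmDiff_singleton (u : Finset (Fin n)) (a : Fin n) :
    (symmDiff u {a}).card = if a ∈ u then u.card - 1 else u.card + 1 := by
  split_ifs with h
  · rw [symmDiff_of_ge (singleton_subset_iff.2 h), sdiff_singleton_eq_erase, card_erase_of_mem h]
  · rw [symmDiff_comm, symmDiff_eq_union (by simpa using h), singleton_union,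
      card_insert_of_notMem h]

/-- Each step flips one element, which changes the sizes of `u ∆ v` and of its complement by one.
The part `u` is generalized since every vertex has two. -/
theorem min_card_le_length (hn : 2 ≤ n) {x y : Vertex n} (p : (graph n).Walk x y)
    {u v : Finset (Fin n)} (hu : x = mk u) (hv : y = mk v) :
    min (symmDiff u v).card (symmDiff u v)ᶜ.card ≤ p.length := by
  induction p generalizing u with
  | nil =>
    subst hu
    rcases mk_eq_mk.1 hv with rfl | rfl
    · simp
    · simp
  | cons hadj p ih =>
    subst hu
    obtain ⟨a, ha⟩ := (adj_mk_iff hn).1 hadj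
    have := ih ha.symm hv
    rw [symmDiff_right_comm, card_compl, card_symmDiff_singleton] at this
    rw [SimpleGraph.Walk.length_cons, card_compl]
    split_ifs at this <;> omega

theorem connected (hn : 2 ≤ n) (x y : Vertex n) : (graph n).Reachable x y := by
  obtain ⟨u, rfl⟩ := exists_mk x
  obtain ⟨v, rfl⟩ := exists_mk y
  exact (dist_le_card hn u v).1

/-- The distance between `{u, uᶜ}` and `{v, vᶜ}` is the smaller size of `u ∆ v` and its
complement. -/
theorem dist_mk (hn : 2 ≤ n) (u v : Finset (Fin n)) :
    (graph n).dist (mk u) (mk v) = min (symmDiff u v).card (symmDiff u v)ᶜ.card := by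
  apply le_antisymm
  · refine le_min (dist_le_card hn u v).2 ?_
    rw [← symmDiff_compl, ← mk_compl v]
    exact (dist_le_card hn u vᶜ).2
  · obtain ⟨p, hp⟩ := (connected hn (mk u) (mk v)).exists_walk_length_eq_dist
    rw [← hp]
    exact min_card_le_length hn p rfl rfl

theorem dist_origin (hn : 2 ≤ n) (u : Finset (Fin n)) :
    (graph n).dist (origin n) (mk u) = min u.card uᶜ.card := by
  have := dist_mk hn ∅ u
  rwa [show symmDiff ∅ u = u from bot_symmDiff u] at this

/-- The adjacency matrix acts by summing over the `n` neighbours of a vertex. -/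
theorem distanceMatrix_one_mulVec (hn : 2 < n) (f : Vertex n → ℂ) (u : Finset (Fin n)) :
    (distanceMatrix (graph n) 1 *ᵥ f) (mk u) = ∑ a, f (mk (symmDiff u {a})) := by
  classical
  have h : ∀ y, distanceMatrix (graph n) 1 (mk u) y * f y =
      if y ∈ univ.image (fun a => mk (symmDiff u {a})) then f y else 0 := by
    intro y
    simp [distanceMatrix, SimpleGraph.dist_eq_one_iff_adj, adj_mk_iff hn.le]
  rw [Matrix.mulVec, dotProduct, sum_congr rfl fun y _ => h y, sum_ite_mem, univ_inter,
    sum_image (mk_symmDiff_singleton_injective hn u).injOn]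

end Vertices

/-! ### Distance matrices of the folded `2D`-cube -/

variable {D : ℕ}

theorem exists_mk_card_le (x : Vertex (2 * D)) : ∃ u, u.card ≤ D ∧ x = mk u := by
  obtain ⟨u, rfl⟩ := exists_mk x
  by_cases h : u.card ≤ D
  · exact ⟨u, h, rfl⟩
  · refine ⟨uᶜ, ?_, (mk_compl u).symm⟩
    rw [card_compl, Fintype.card_fin]
    omega

theorem dist_mk_of_card_le (hD : 2 ≤ D) {u v : Finset (Fin (2 * D))}
    (h : (symmDiff u v).card ≤ D) :
    (graph (2 * D)).dist (mk u) (mk v) = (symmDiff u v).card := by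
  rw [dist_mk (by omega), card_compl, Fintype.card_fin]
  omega

theorem dist_origin_of_card_le (hD : 2 ≤ D) {u : Finset (Fin (2 * D))} (h : u.card ≤ D) :
    (graph (2 * D)).dist (origin (2 * D)) (mk u) = u.card := by
  rw [dist_origin (by omega), card_compl, Fintype.card_fin]
  omega

theorem dist_le (hD : 2 ≤ D) (x y : Vertex (2 * D)) : (graph (2 * D)).dist x y ≤ D := by
  obtain ⟨u, rfl⟩ := exists_mk x
  obtain ⟨v, rfl⟩ := exists_mk y
  rw [dist_mk (by omega), card_compl, Fintype.card_fin]
  omega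

theorem distanceMatrix_of_gt (hD : 2 ≤ D) {k : ℕ} (hk : D < k) :
    distanceMatrix (graph (2 * D)) k = 0 := by
  ext x y
  have := dist_le hD x y
  simp only [distanceMatrix, Matrix.of_apply, Matrix.zero_apply, ite_eq_right_iff]
  omega

theorem distanceMatrix_zero (hD : 2 ≤ D) : distanceMatrix (graph (2 * D)) 0 = 1 := by
  ext x y
  simp [distanceMatrix, Matrix.one_apply, (connected (by omega) x y).dist_eq_zero_iff]

theorem exists_rep_symmDiff_card_le (x : Vertex (2 * D)) (v : Finset (Fin (2 * D))) :
    ∃ u, x = mk u ∧ (symmDiff u v).card ≤ D := by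
  obtain ⟨u, rfl⟩ := exists_mk x
  by_cases h : (symmDiff u v).card ≤ D
  · exact ⟨u, rfl, h⟩
  · refine ⟨uᶜ, (mk_compl u).symm, ?_⟩
    rw [compl_symmDiff, card_compl, Fintype.card_fin]
    omega

/-- Three-term recurrence of a distance-regular graph. There is no `A_k` term because the folded
`2D`-cube is bipartite; the coefficient doubles at `k + 1 = D` because all `2D` neighbours of an
antipodal vertex are at distance `D - 1`. -/
theorem distanceMatrix_one_mul (hD : 2 ≤ D) (k : ℕ) (hk : k + 1 < D + 1) :
    distanceMatrix (graph (2 * D)) 1 * distanceMatrix (graph (2 * D)) k =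
      (if k + 1 = D then 2 * (k + 1 : ℂ) else k + 1) • distanceMatrix (graph (2 * D)) (k + 1) +
      if k = 0 then 0 else (2 * D - k + 1 : ℂ) • distanceMatrix (graph (2 * D)) (k - 1) := by
  ext x y
  obtain ⟨v, rfl⟩ := exists_mk y
  obtain ⟨u, rfl, hs⟩ := exists_rep_symmDiff_card_le x v
  have h1 := distanceMatrix_one_mulVec (by omega)
    (fun z => distanceMatrix (graph (2 * D)) k z (mk v)) u
  rw [Matrix.mul_apply]
  refine h1.trans ?_
  set s := symmDiff u v with hsdef
  -- Flipping `a ∈ s` decreases the distance. Flipping `a ∉ s` increases it, unless `|s| = D`, where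
  -- the complement becomes the smaller side.
  have h2 : ∀ a, distanceMatrix (graph (2 * D)) k (mk (symmDiff u {a})) (mk v) =
      if a ∈ s then (if s.card = k + 1 then 1 else 0) else
        (if s.card < D then if s.card + 1 = k then 1 else 0
          else if s.card = k + 1 then 1 else 0) := by
    intro a
    simp only [distanceMatrix, Matrix.of_apply]
    rw [dist_mk (by omega), symmDiff_right_comm, ← hsdef, card_compl, Fintype.card_fin,
      card_symmDiff_singleton]
    by_cases h : a ∈ s
    · have := card_pos.2 ⟨a, h⟩
      simp only [h, if_true]
      exact if_congr (by omega) rfl rfl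
    · simp only [h, if_false]
      by_cases h' : s.card < D
      · simp only [h', if_true]
        exact if_congr (by omega) rfl rfl
      · simp only [h', if_false]
        exact if_congr (by omega) rfl rfl
  rw [sum_congr rfl fun a _ => h2 a, sum_ite, sum_const, sum_const, filter_mem_eq_inter,
    univ_inter, filter_notMem_eq_sdiff, ← compl_eq_univ_sdiff, card_compl, Fintype.card_fin,
    nsmul_eq_mul, nsmul_eq_mul, Nat.cast_sub (by omega)]
  have h3 : ∀ i, distanceMatrix (graph (2 * D)) i (mk u) (mk v) = if s.card = i then 1 else 0 := by
    intro i
    simp only [distanceMatrix, Matrix.of_apply]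
    rw [dist_mk_of_card_le hD hs]
  rw [Matrix.add_apply, Matrix.smul_apply, h3]
  have h4 : (if k = 0 then 0 else (2 * D - k + 1 : ℂ) • distanceMatrix (graph (2 * D)) (k - 1) :
      Matrix (Vertex (2 * D)) (Vertex (2 * D)) ℂ) (mk u) (mk v) =
      if s.card + 1 = k then (2 * D - k + 1 : ℂ) else 0 := by
    rcases k with _ | k
    · simp
    · simp [h3]
  rw [h4]
  generalize s.card = c at hs
  have h5 : c = k + 1 ∨ c + 1 = k ∨ (c ≠ k + 1 ∧ c + 1 ≠ k) := by omega
  rcases h5 with rfl | rfl | h5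
  · have h6 : k + 1 + 1 ≠ k := by omega
    by_cases hkD : k + 1 = D
    · subst hkD
      simp only [lt_irrefl, if_true, if_false, smul_eq_mul, h6]
      push_cast
      ring
    · have h7 : k + 1 < D := by omega
      simp [hkD, h6, h7]
  · have h6 : c ≠ c + 1 + 1 := by omega
    have h7 : c < D := by omega
    simp [h6, h7]
    ring
  · simp [h5]

theorem distanceMatrix_mem_adjoin (hD : 2 ≤ D) (k : ℕ) :
    distanceMatrix (graph (2 * D)) k ∈
      Algebra.adjoin ℂ {distanceMatrix (graph (2 * D)) 1} := by
  induction k using Nat.strong_induction_on with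
  | _ k ih =>
    rcases k with _ | k
    · rw [distanceMatrix_zero hD]
      exact one_mem _
    · by_cases hk : k + 1 < D + 1
      · have h := distanceMatrix_one_mul hD k hk
        set c : ℂ := if k + 1 = D then 2 * (k + 1 : ℂ) else k + 1 with hc
        have hk0 : (k + 1 : ℂ) ≠ 0 := by exact_mod_cast k.succ_ne_zero
        have hc0 : c ≠ 0 := by
          rw [hc]
          split_ifs
          · exact mul_ne_zero two_ne_zero hk0
          · exact hk0
        have e : distanceMatrix (graph (2 * D)) (k + 1) = c⁻¹ •
            (distanceMatrix (graph (2 * D)) 1 * distanceMatrix (graph (2 * D)) k -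
              if k = 0 then 0 else (2 * D - k + 1 : ℂ) •
                distanceMatrix (graph (2 * D)) (k - 1)) := by
          rw [h, add_sub_cancel_right, inv_smul_smul₀ hc0]
        rw [e]
        refine Subalgebra.smul_mem _ (sub_mem (mul_mem ?_ (ih k (by omega))) ?_) _
        · exact Algebra.subset_adjoin rfl
        · split_ifs
          · exact zero_mem _
          · exact Subalgebra.smul_mem _ (ih (k - 1) (by omega)) _
      · rw [distanceMatrix_of_gt hD (k := k + 1) (by omega)]
        exact zero_mem _

/-! ### Raising and lowering matrices -/

/-- The part of the adjacency matrix leading from level `k` to level `k + 1`. -/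
def raise (D k : ℕ) : Matrix (Vertex (2 * D)) (Vertex (2 * D)) ℂ :=
  dualIdempotent (graph (2 * D)) (origin (2 * D)) (k + 1) * distanceMatrix (graph (2 * D)) 1 *
    dualIdempotent (graph (2 * D)) (origin (2 * D)) k

/-- The part of the adjacency matrix leading from level `k + 1` to level `k`. -/
def lower (D k : ℕ) : Matrix (Vertex (2 * D)) (Vertex (2 * D)) ℂ :=
  dualIdempotent (graph (2 * D)) (origin (2 * D)) k * distanceMatrix (graph (2 * D)) 1 *
    dualIdempotent (graph (2 * D)) (origin (2 * D)) (k + 1)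

theorem dualIdempotent_mulVec {V : Type*} [Fintype V] [DecidableEq V] (G : SimpleGraph V)
    (x : V) (k : ℕ) (f : V → ℂ) (y : V) :
    (dualIdempotent G x k *ᵥ f) y = if G.dist x y = k then f y else 0 := by
  simp [dualIdempotent, Matrix.mulVec_diagonal]

theorem dualIdempotent_conjTranspose {V : Type*} [DecidableEq V] (G : SimpleGraph V)
    (x : V) (k : ℕ) : (dualIdempotent G x k)ᴴ = dualIdempotent G x k := by
  rw [dualIdempotent, Matrix.diagonal_conjTranspose]
  congr 1
  ext y
  simp only [Pi.star_apply, apply_ite star, star_one, star_zero]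

theorem distanceMatrix_conjTranspose {V : Type*} (G : SimpleGraph V) (k : ℕ) :
    (distanceMatrix G k)ᴴ = distanceMatrix G k := by
  ext x y
  simp only [distanceMatrix, Matrix.conjTranspose_apply, Matrix.of_apply, apply_ite star,
    star_one, star_zero, G.dist_comm]

theorem lower_conjTranspose (k : ℕ) : (lower D k)ᴴ = raise D k := by
  rw [lower, raise, Matrix.conjTranspose_mul, Matrix.conjTranspose_mul,
    dualIdempotent_conjTranspose, dualIdempotent_conjTranspose, distanceMatrix_conjTranspose,
    Matrix.mul_assoc]

theorem dotProduct_lower (k : ℕ) (f g : Vertex (2 * D) → ℂ) :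
    star f ⬝ᵥ (lower D k *ᵥ g) = star (raise D k *ᵥ f) ⬝ᵥ g := by
  rw [Matrix.star_mulVec, ← lower_conjTranspose, Matrix.conjTranspose_conjTranspose,
    Matrix.dotProduct_mulVec]

theorem lower_mulVec_dualIdempotent (k : ℕ) (f : Vertex (2 * D) → ℂ) :
    lower D k *ᵥ (dualIdempotent (graph (2 * D)) (origin (2 * D)) (k + 1) *ᵥ f) =
      lower D k *ᵥ f := by
  have h : dualIdempotent (graph (2 * D)) (origin (2 * D)) (k + 1) *ᵥ
      (dualIdempotent (graph (2 * D)) (origin (2 * D)) (k + 1) *ᵥ f) =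
      dualIdempotent (graph (2 * D)) (origin (2 * D)) (k + 1) *ᵥ f := by
    ext x
    simp only [dualIdempotent_mulVec]
    split_ifs <;> rfl
  simp only [lower, ← Matrix.mulVec_mulVec]
  rw [h]

theorem dualIdempotent_mulVec_lower (k : ℕ) (f : Vertex (2 * D) → ℂ) :
    dualIdempotent (graph (2 * D)) (origin (2 * D)) k *ᵥ (lower D k *ᵥ f) = lower D k *ᵥ f := by
  ext x
  simp only [lower, ← Matrix.mulVec_mulVec, dualIdempotent_mulVec]
  split_ifs <;> rfl

theorem sum_symmDiff_singleton {n : ℕ} (F : Finset (Fin n) → ℂ) (u : Finset (Fin n)) :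
    ∑ a, F (symmDiff u {a}) = ∑ a ∈ u, F (u.erase a) + ∑ a ∈ uᶜ, F (insert a u) := by
  rw [← sum_add_sum_compl u]
  congr 1
  · refine sum_congr rfl fun a ha => ?_
    rw [symmDiff_of_ge (singleton_subset_iff.2 ha), sdiff_singleton_eq_erase]
  · refine sum_congr rfl fun a ha => ?_
    rw [symmDiff_comm, symmDiff_eq_union (by simpa using ha), singleton_union]

theorem raise_mulVec_of_ne (hD : 2 ≤ D) {k : ℕ} (f : Vertex (2 * D) → ℂ)
    {u : Finset (Fin (2 * D))} (hu : u.card ≤ D) (hk : u.card ≠ k + 1) :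
    (raise D k *ᵥ f) (mk u) = 0 := by
  rw [raise, ← Matrix.mulVec_mulVec, ← Matrix.mulVec_mulVec, dualIdempotent_mulVec,
    dist_origin_of_card_le hD hu, if_neg hk]

theorem lower_mulVec_of_ne (hD : 2 ≤ D) {k : ℕ} (f : Vertex (2 * D) → ℂ)
    {u : Finset (Fin (2 * D))} (hu : u.card ≤ D) (hk : u.card ≠ k) :
    (lower D k *ᵥ f) (mk u) = 0 := by
  rw [lower, ← Matrix.mulVec_mulVec, ← Matrix.mulVec_mulVec, dualIdempotent_mulVec,
    dist_origin_of_card_le hD hu, if_neg hk]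

theorem raise_mulVec_of_lt (hD : 2 ≤ D) {k : ℕ} (f : Vertex (2 * D) → ℂ)
    {u : Finset (Fin (2 * D))} (hu : u.card = k + 1) (hk : k + 1 < D) :
    (raise D k *ᵥ f) (mk u) = ∑ a ∈ u, f (mk (u.erase a)) := by
  rw [raise, ← Matrix.mulVec_mulVec, ← Matrix.mulVec_mulVec, dualIdempotent_mulVec,
    dist_origin_of_card_le hD (by omega), if_pos hu, distanceMatrix_one_mulVec (by omega),
    sum_symmDiff_singleton fun v => (dualIdempotent _ _ k *ᵥ f) (mk v)]
  rw [sum_eq_zero (s := uᶜ), add_zero]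
  · refine sum_congr rfl fun a ha => ?_
    have := card_erase_of_mem ha
    rw [dualIdempotent_mulVec, dist_origin_of_card_le hD (by omega), if_pos (by omega)]
  · intro a ha
    have := card_insert_of_notMem (mem_compl.1 ha)
    rw [dualIdempotent_mulVec, dist_origin_of_card_le hD (by omega), if_neg (by omega)]

/-- At the middle level every neighbour lies one level down: `insert a u` represents the same vertex
as `uᶜ.erase a`. -/
theorem raise_mulVec_of_eq (hD : 2 ≤ D) {k : ℕ} (f : Vertex (2 * D) → ℂ)
    {u : Finset (Fin (2 * D))} (hu : u.card = k + 1) (hk : k + 1 = D) :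
    (raise D k *ᵥ f) (mk u) = ∑ a ∈ u, f (mk (u.erase a)) + ∑ a ∈ uᶜ, f (mk (uᶜ.erase a)) := by
  rw [raise, ← Matrix.mulVec_mulVec, ← Matrix.mulVec_mulVec, dualIdempotent_mulVec,
    dist_origin_of_card_le hD (by omega), if_pos hu, distanceMatrix_one_mulVec (by omega),
    sum_symmDiff_singleton fun v => (dualIdempotent _ _ k *ᵥ f) (mk v)]
  congr 1
  · refine sum_congr rfl fun a ha => ?_
    have := card_erase_of_mem ha
    rw [dualIdempotent_mulVec, dist_origin_of_card_le hD (by omega), if_pos (by omega)]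
  · refine sum_congr rfl fun a ha => ?_
    have := card_erase_of_mem ha
    rw [card_compl, Fintype.card_fin] at this
    rw [← mk_compl (insert a u), compl_insert, dualIdempotent_mulVec,
      dist_origin_of_card_le hD (by omega), if_pos (by omega)]

theorem lower_mulVec (hD : 2 ≤ D) {k : ℕ} (f : Vertex (2 * D) → ℂ)
    {u : Finset (Fin (2 * D))} (hu : u.card = k) (hk : k < D) :
    (lower D k *ᵥ f) (mk u) = ∑ a ∈ uᶜ, f (mk (insert a u)) := by
  rw [lower, ← Matrix.mulVec_mulVec, ← Matrix.mulVec_mulVec, dualIdempotent_mulVec,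
    dist_origin_of_card_le hD (by omega), if_pos hu, distanceMatrix_one_mulVec (by omega),
    sum_symmDiff_singleton fun v => (dualIdempotent _ _ (k + 1) *ᵥ f) (mk v)]
  rw [sum_eq_zero (s := u), zero_add]
  · refine sum_congr rfl fun a ha => ?_
    have := card_insert_of_notMem (mem_compl.1 ha)
    rw [dualIdempotent_mulVec, dist_origin_of_card_le hD (by omega), if_pos (by omega)]
  · intro a ha
    have := card_erase_of_mem ha
    rw [dualIdempotent_mulVec, dist_origin_of_card_le hD (by omega), if_neg (by omega)]

/-- Adjacent vertices lie on neighbouring levels. -/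
theorem distanceMatrix_one_eq_sum (hD : 2 ≤ D) :
    distanceMatrix (graph (2 * D)) 1 = ∑ k ∈ range D, (raise D k + lower D k) := by
  refine Matrix.ext_of_mulVec_single fun y => ?_
  generalize (Pi.single y 1 : Vertex (2 * D) → ℂ) = f
  ext x
  obtain ⟨u, hu, rfl⟩ := exists_mk_card_le x
  rw [distanceMatrix_one_mulVec (by omega), Matrix.sum_mulVec, Finset.sum_apply,
    sum_symmDiff_singleton fun v => f (mk v)]
  simp only [Matrix.add_mulVec, Pi.add_apply]
  rw [sum_add_distrib]
  rcases hu.lt_or_eq with hlt | heq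
  · congr 1
    · rcases Nat.eq_zero_or_pos u.card with h0 | h0
      · rw [card_eq_zero.1 h0, sum_empty, sum_eq_zero]
        intro k _
        exact raise_mulVec_of_ne hD f (by simp) (by simp)
      · rw [sum_eq_single (u.card - 1), raise_mulVec_of_lt hD f (by omega) (by omega)]
        · intro k _ hk
          exact raise_mulVec_of_ne hD f hu (by omega)
        · intro h
          rw [mem_range] at h
          omega
    · rw [sum_eq_single u.card, lower_mulVec hD f rfl hlt]
      · intro k _ hk
        exact lower_mulVec_of_ne hD f hu hk.symm
      · intro h
        exact absurd (mem_range.2 hlt) h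
  · rw [sum_eq_single (D - 1), raise_mulVec_of_eq hD f (by omega) (by omega),
      sum_eq_zero (s := range D), add_zero]
    · congr 1
      refine sum_congr rfl fun a _ => ?_
      rw [← mk_compl (insert a u), compl_insert]
    · intro k hk
      rw [mem_range] at hk
      exact lower_mulVec_of_ne hD f hu (by omega)
    · intro k _ hk
      exact raise_mulVec_of_ne hD f hu (by omega)
    · intro h
      rw [mem_range] at h
      omega

/-! ### The spaces `L_r` -/

-- The maximal intersection has size `s = |u|` exactly when `u` lies in an `(s+1)`-element part of
-- `y`, which is adjacency. Hence the condition defining `L_r` is that of being killed by lowering.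
open Classical in
theorem orbitMatrix_eq_lower (hD : 2 ≤ D) {s : ℕ} (hs : s + 1 ≤ D) :
    orbitMatrix D s (s + 1) s = lower D s := by
  ext x y
  have h1 : lower D s x y = if (graph (2 * D)).dist (origin (2 * D)) x = s ∧
      (graph (2 * D)).dist (origin (2 * D)) y = s + 1 ∧ (graph (2 * D)).Adj x y then 1 else 0 := by
    rw [lower, dualIdempotent, dualIdempotent, Matrix.mul_diagonal, Matrix.diagonal_mul]
    simp only [distanceMatrix, Matrix.of_apply, SimpleGraph.dist_eq_one_iff_adj]
    split_ifs <;> simp_all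
  rw [h1, orbitMatrix, Matrix.of_apply]
  refine if_congr (and_congr_right fun hx => and_congr_right fun hy => ?_) rfl rfl
  obtain ⟨u, hu, rfl⟩ := exists_mk_card_le x
  rw [dist_origin_of_card_le hD hu] at hx
  constructor
  · rintro ⟨⟨u', hu', v', hv', hcu, hcv, hc⟩, -⟩
    have e1 : mk u = mk u' := by
      rcases mem_mk.1 hu' with rfl | rfl
      · rfl
      · exact (mk_compl u).symm
    obtain ⟨v, rfl⟩ := exists_mk y
    have e2 : mk v = mk v' := by
      rcases mem_mk.1 hv' with rfl | rfl
      · rfl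
      · exact (mk_compl v).symm
    rw [e1, e2, adj_mk]
    have hsub : u' ⊆ v' := by
      rw [← eq_of_subset_of_card_le (inter_subset_left : u' ∩ v' ⊆ u') (by omega)]
      exact inter_subset_right
    have hcard : (symmDiff u' v').card = 1 := by
      rw [symmDiff_of_le hsub, card_sdiff_of_subset hsub]
      omega
    rw [hcard, card_compl, hcard, Fintype.card_fin]
    omega
  · intro h
    obtain ⟨a, rfl⟩ := (adj_mk_iff (by omega)).1 h
    have ha : a ∉ u := by
      intro ha
      have := card_symmDiff_singleton u a
      rw [if_pos ha] at this
      rw [dist_origin_of_card_le hD (by omega)] at hy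
      omega
    have e : symmDiff u {a} = insert a u := by
      rw [symmDiff_comm, symmDiff_eq_union (by simpa using ha), singleton_union]
    rw [e]
    refine ⟨⟨u, mem_mk.2 (Or.inl rfl), insert a u, mem_mk.2 (Or.inl rfl), hx,
      by rw [card_insert_of_notMem ha, hx], ?_⟩, ?_⟩
    · rw [inter_eq_left.2 (subset_insert a u), hx]
    · rintro m ⟨u', -, v', -, hcu, -, rfl⟩
      exact hcu ▸ card_le_card inter_subset_left

theorem dualIdempotent_mulVec_eq_self_iff (hD : 2 ≤ D) {r : ℕ} (hr : r ≤ D)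
    (ξ : Vertex (2 * D) → ℂ) :
    dualIdempotent (graph (2 * D)) (origin (2 * D)) r *ᵥ ξ = ξ ↔
      ∀ x : Vertex (2 * D), (∀ u ∈ x.1, u.card ≠ r) → ξ x = 0 := by
  have key : ∀ x : Vertex (2 * D), (∀ u ∈ x.1, u.card ≠ r) ↔
      (graph (2 * D)).dist (origin (2 * D)) x ≠ r := by
    intro x
    obtain ⟨u, hu, rfl⟩ := exists_mk_card_le x
    have hc := card_compl u
    rw [Fintype.card_fin] at hc
    rw [dist_origin_of_card_le hD hu]
    constructor
    · intro h
      exact h u (mem_mk.2 (Or.inl rfl))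
    · intro h v hv
      rcases mem_mk.1 hv with rfl | rfl
      · exact h
      · omega
  rw [funext_iff]
  refine forall_congr' fun x => ?_
  rw [key, dualIdempotent_mulVec]
  split_ifs with h
  · simp [h]
  · simp [h, eq_comm]

theorem mem_lowestSpace_iff (hD : 2 ≤ D) {r : ℕ} (hr : r ≤ D)
    (ξ : EuclideanSpace ℂ (Vertex (2 * D))) :
    ξ ∈ lowestSpace D r ↔ (∀ s, r = s + 1 → lower D s *ᵥ ξ.ofLp = 0) ∧
      dualIdempotent (graph (2 * D)) (origin (2 * D)) r *ᵥ ξ.ofLp = ξ.ofLp := by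
  rw [dualIdempotent_mulVec_eq_self_iff hD hr]
  change (_ ∧ _) ↔ _
  refine and_congr_left fun _ => forall₂_congr fun s hs => ?_
  subst hs
  rw [orbitMatrix_eq_lower hD hr]

theorem isLowest_of_mem (hD : 2 ≤ D) {r : ℕ} (hr : r ≤ D)
    {ξ : EuclideanSpace ℂ (Vertex (2 * D))} (hξ : ξ ∈ lowestSpace D r) :
    IsLowest r fun u => ξ.ofLp (mk u) := by
  intro v hv
  rw [← lower_mulVec hD ξ.ofLp rfl (by omega : v.card < D),
    ((mem_lowestSpace_iff hD hr ξ).1 hξ).1 v.card hv.symm]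
  rfl

/-! ### Functions on a level given by functions of subsets -/

/-- A part of size at most `D` of a vertex. -/
def rep (x : Vertex (2 * D)) : Finset (Fin (2 * D)) := (exists_mk_card_le x).choose

theorem card_rep_le (x : Vertex (2 * D)) : (rep x).card ≤ D := (exists_mk_card_le x).choose_spec.1

theorem mk_rep (x : Vertex (2 * D)) : mk (rep x) = x := (exists_mk_card_le x).choose_spec.2.symm

/-- The function on the vertices supported on level `i` and given there by `G`. -/
def levelLift (i : ℕ) (G : Finset (Fin (2 * D)) → ℂ) (x : Vertex (2 * D)) : ℂ :=
  if (graph (2 * D)).dist (origin (2 * D)) x = i then G (rep x) else 0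

/-- Below level `D` the part of size at most `D` is unique. At level `D` the choice made by `rep` is
arbitrary, and the symmetry of `G` makes it harmless. -/
theorem levelLift_mk (hD : 2 ≤ D) {i : ℕ} (hi : i ≤ D) {G : Finset (Fin (2 * D)) → ℂ}
    (hG : i = D → ∀ u, G uᶜ = G u) {u : Finset (Fin (2 * D))} (hu : u.card = i) :
    levelLift i G (mk u) = G u := by
  rw [levelLift, dist_origin_of_card_le hD (by omega), if_pos hu]
  rcases mk_eq_mk.1 (mk_rep (mk u)) with h | h
  · rw [h]
  · rw [h, hG]
    have := card_rep_le (mk u)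
    rw [h, card_compl, Fintype.card_fin] at this
    omega

theorem levelLift_mk_of_ne (hD : 2 ≤ D) {i : ℕ} (G : Finset (Fin (2 * D)) → ℂ)
    {u : Finset (Fin (2 * D))} (hu : u.card ≤ D) (h : u.card ≠ i) :
    levelLift i G (mk u) = 0 := by
  rw [levelLift, dist_origin_of_card_le hD hu, if_neg h]

theorem dualIdempotent_mulVec_levelLift (k i : ℕ) (G : Finset (Fin (2 * D)) → ℂ) :
    dualIdempotent (graph (2 * D)) (origin (2 * D)) k *ᵥ levelLift i G =
      if i = k then levelLift i G else 0 := by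
  ext x
  rw [dualIdempotent_mulVec, levelLift]
  split_ifs with h1 h2 h3 h4 <;> simp_all [levelLift]

/-! ### Nonvanishing of `L_r` -/

section Nonzero

variable {α : Type*} [DecidableEq α] [Fintype α] {r : ℕ}

/-- The product of `[lo k ∈ u] - [hi k ∈ u]` over all `k`. -/
def pairProd (lo hi : Fin r → α) (u : Finset α) : ℂ :=
  ∏ k, ((if lo k ∈ u then 1 else 0) - if hi k ∈ u then 1 else 0)

theorem pairProd_compl (lo hi : Fin r → α) (u : Finset α) :
    pairProd lo hi uᶜ = (-1) ^ r * pairProd lo hi u := by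
  have h : ∀ k, ((if lo k ∈ uᶜ then 1 else 0) - if hi k ∈ uᶜ then 1 else 0 : ℂ) =
      -1 * ((if lo k ∈ u then 1 else 0) - if hi k ∈ u then 1 else 0) := by
    intro k
    simp only [mem_compl]
    split_ifs <;> simp
  rw [pairProd, prod_congr rfl fun k _ => h k, prod_mul_distrib, prod_const, card_univ,
    Fintype.card_fin, pairProd]

/-- A set `v` with `r - 1` elements misses both members of some pair `k`. The `k`-th factor kills
every `insert a v` except for `a = lo k` and `a = hi k`, whose products are opposite. -/
theorem isLowest_pairProd {lo hi : Fin r → α} (hlo : Function.Injective lo)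
    (hhi : Function.Injective hi) (hne : ∀ j k, lo j ≠ hi k) : IsLowest r (pairProd lo hi) := by
  intro v hv
  obtain ⟨k, hk1, hk2⟩ : ∃ k, lo k ∉ v ∧ hi k ∉ v := by
    by_contra! h
    have := card_le_card_of_injOn (s := univ) (t := v)
      (fun k => if lo k ∈ v then lo k else hi k)
      (by
        intro k _
        by_cases hk : lo k ∈ v
        · simp [hk]
        · simp [hk, h k hk])
      (by
        intro j _ k _ hjk
        dsimp only at hjk
        split_ifs at hjk
        · exact hlo hjk
        · exact absurd hjk (hne _ _)
        · exact absurd hjk.symm (hne _ _)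
        · exact hhi hjk)
    rw [card_univ, Fintype.card_fin] at this
    omega
  have hsub : ({lo k, hi k} : Finset α) ⊆ vᶜ := by
    intro a ha
    rw [mem_insert, mem_singleton] at ha
    rcases ha with rfl | rfl
    · exact mem_compl.2 hk1
    · exact mem_compl.2 hk2
  rw [← sum_subset hsub, sum_pair (hne k k), pairProd, pairProd, ← mul_prod_erase univ _ (mem_univ k),
    ← mul_prod_erase univ (fun j => ((if lo j ∈ insert (hi k) v then 1 else 0) -
      if hi j ∈ insert (hi k) v then 1 else 0 : ℂ)) (mem_univ k)]
  · have e : ∀ j ∈ univ.erase k, ((if lo j ∈ insert (hi k) v then 1 else 0) -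
        if hi j ∈ insert (hi k) v then 1 else 0 : ℂ) =
        (if lo j ∈ insert (lo k) v then 1 else 0) - if hi j ∈ insert (lo k) v then 1 else 0 := by
      intro j hj
      have hj := (mem_erase.1 hj).1
      simp [hne, (hne _ _).symm, hlo.ne hj, hhi.ne hj]
    rw [prod_congr rfl e]
    simp [hne, (hne _ _).symm, hk1, hk2]
  · intro a _ ha
    rw [mem_insert, mem_singleton, not_or] at ha
    rw [pairProd, prod_eq_zero (mem_univ k)]
    simp [hk1, hk2, Ne.symm ha.1, Ne.symm ha.2]

omit [Fintype α] in
theorem pairProd_image {lo hi : Fin r → α} (hne : ∀ j k, lo j ≠ hi k) :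
    pairProd lo hi (univ.image lo) = 1 := by
  refine prod_eq_one fun k _ => ?_
  simp [hne]

end Nonzero

/-- Needed so that every block really occurs. Evenness of `D` enters for `r = D`, where the product
must take the same value on `u` and `uᶜ` to define a function of vertices. -/
theorem exists_mem_lowestSpace_ne_zero (hD : 2 ≤ D) (hDe : Even D) {r : ℕ} (hr : r ≤ D) :
    ∃ ξ ∈ lowestSpace D r, ξ ≠ 0 := by
  let lo : Fin r → Fin (2 * D) := fun k => ⟨k, by omega⟩
  let hi : Fin r → Fin (2 * D) := fun k => ⟨2 * D - 1 - k, by omega⟩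
  have hlo : Function.Injective lo := fun j k h => by
    have := congrArg Fin.val h
    exact Fin.ext this
  have hhi : Function.Injective hi := fun j k h => by
    have := congrArg Fin.val h
    simp only [hi] at this
    omega
  have hne : ∀ j k, lo j ≠ hi k := fun j k h => by
    have := congrArg Fin.val h
    simp only [lo, hi] at this
    omega
  have hG : r = D → ∀ u, pairProd lo hi uᶜ = pairProd lo hi u := by
    rintro rfl u
    rw [pairProd_compl, hDe.neg_one_pow, one_mul]
  refine ⟨WithLp.toLp 2 (levelLift r (pairProd lo hi)), ?_, ?_⟩
  · rw [mem_lowestSpace_iff hD hr]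
    refine ⟨?_, by rw [dualIdempotent_mulVec_levelLift, if_pos rfl]⟩
    rintro s rfl
    ext x
    obtain ⟨u, hu, rfl⟩ := exists_mk_card_le x
    by_cases hs : u.card = s
    · rw [lower_mulVec hD _ hs (by omega)]
      refine Eq.trans ?_ (isLowest_pairProd hlo hhi hne u (by rw [hs]))
      refine sum_congr rfl fun a ha => ?_
      exact levelLift_mk hD hr hG (by rw [card_insert_of_notMem (mem_compl.1 ha), hs])
    · exact lower_mulVec_of_ne hD _ hu hs
  · intro h
    have h1 := levelLift_mk hD hr hG (u := univ.image lo)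
      (by rw [card_image_of_injective _ hlo, card_univ, Fintype.card_fin])
    rw [pairProd_image hne] at h1
    have h2 := congrArg (fun ξ => ξ.ofLp (mk (univ.image lo))) h
    simp only [WithLp.ofLp_zero, Pi.zero_apply] at h2
    rw [h1] at h2
    exact one_ne_zero h2

/-! ### The vectors generated by lowest vectors -/

theorem mem_levels {r i : ℕ} (hD : 2 ≤ D) :
    i ∈ levels D r ↔ r ≤ i ∧ i ≤ D ∧ (i = D → Even r) := by
  unfold levels
  split_ifs with h
  · simp [h]
  · simp only [mem_Icc, h, imp_false]
    omega

/-- The function on level `i` whose value at `u` is the sum of `ξ` over the `r`-subsets of `u`. -/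
def weight (r i : ℕ) (ξ : Vertex (2 * D) → ℂ) : Vertex (2 * D) → ℂ :=
  levelLift i (subsetSum r fun u => ξ (mk u))

theorem weight_mk (hD : 2 ≤ D) {r i : ℕ} {ξ : Vertex (2 * D) → ℂ}
    (hξ : IsLowest r fun u => ξ (mk u)) (hi : i ≤ D) (hr : i = D → Even r)
    {u : Finset (Fin (2 * D))} (hu : u.card = i) :
    weight r i ξ (mk u) = subsetSum r (fun u => ξ (mk u)) u := by
  refine levelLift_mk hD hi (fun h v => ?_) hu
  rw [hξ.subsetSum_compl, (hr h).neg_one_pow, one_mul]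

theorem weight_of_lt (hD : 2 ≤ D) {r i : ℕ} (h : i < r) (ξ : Vertex (2 * D) → ℂ) :
    weight r i ξ = 0 := by
  ext x
  rw [weight, levelLift]
  split_ifs with hx
  · rw [subsetSum_of_card_lt]
    · rfl
    · rw [← mk_rep x, dist_origin_of_card_le hD (card_rep_le x)] at hx
      rwa [hx]
  · rfl

theorem weight_self (hD : 2 ≤ D) {r : ℕ} {ξ : Vertex (2 * D) → ℂ}
    (h : dualIdempotent (graph (2 * D)) (origin (2 * D)) r *ᵥ ξ = ξ) : weight r r ξ = ξ := by
  ext x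
  rw [weight, levelLift, ← congrFun h x, dualIdempotent_mulVec]
  split_ifs with hx
  · rw [subsetSum_of_card_eq, mk_rep]
    rwa [← mk_rep x, dist_origin_of_card_le hD (card_rep_le x)] at hx
  · rfl

theorem weight_add (r i : ℕ) (ξ η : Vertex (2 * D) → ℂ) :
    weight r i (ξ + η) = weight r i ξ + weight r i η := by
  ext x
  simp only [weight, levelLift, Pi.add_apply, subsetSum, sum_add_distrib]
  split_ifs <;> simp

theorem weight_smul (r i : ℕ) (c : ℂ) (ξ : Vertex (2 * D) → ℂ) :
    weight r i (c • ξ) = c • weight r i ξ := by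
  ext x
  simp only [weight, levelLift, Pi.smul_apply, subsetSum, ← smul_sum]
  split_ifs <;> simp

theorem dualIdempotent_mulVec_weight (k r i : ℕ) (ξ : Vertex (2 * D) → ℂ) :
    dualIdempotent (graph (2 * D)) (origin (2 * D)) k *ᵥ weight r i ξ =
      if i = k then weight r i ξ else 0 :=
  dualIdempotent_mulVec_levelLift _ _ _

/-- The coefficient with which the raising matrix takes level `k` to level `k + 1`. -/
def raiseCoeff (D r k : ℕ) : ℂ := if k + 1 = D then 2 * ((D : ℂ) - r) else k + 1 - r

theorem raiseCoeff_ne_zero {r k : ℕ} (hr : r < k + 1) : raiseCoeff D r k ≠ 0 := by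
  have h : (k + 1 : ℂ) - r ≠ 0 := by
    rw [sub_ne_zero]
    exact_mod_cast hr.ne'
  unfold raiseCoeff
  split_ifs with hk
  · subst hk
    push_cast
    exact mul_ne_zero two_ne_zero h
  · exact h

/-- Below level `D` this is `sum_subsetSum_erase`. At level `D` both parts of the vertex contribute,
equally for even `r`, which doubles the coefficient. -/
theorem raise_mulVec_weight (hD : 2 ≤ D) {r k : ℕ} {ξ : Vertex (2 * D) → ℂ}
    (hξ : IsLowest r fun u => ξ (mk u)) (hk : k < D) (hr : k + 1 = D → Even r) :
    raise D k *ᵥ weight r k ξ = raiseCoeff D r k • weight r (k + 1) ξ := by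
  ext x
  obtain ⟨u, hu, rfl⟩ := exists_mk_card_le x
  rw [Pi.smul_apply, smul_eq_mul]
  by_cases hc : u.card = k + 1
  · have h1 : ∀ v : Finset (Fin (2 * D)), v.card = k + 1 → ∑ a ∈ v, weight r k ξ (mk (v.erase a)) =
        ((v.card : ℂ) - r) * subsetSum r (fun u => ξ (mk u)) v := by
      intro v hv
      rw [← sum_subsetSum_erase]
      refine sum_congr rfl fun a ha => weight_mk hD hξ hk.le (by omega) ?_
      rw [card_erase_of_mem ha]
      omega
    rw [weight_mk hD hξ hk hr hc, raiseCoeff]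
    split_ifs with hkD
    · have hcc : uᶜ.card = k + 1 := by
        rw [card_compl, Fintype.card_fin]
        omega
      rw [raise_mulVec_of_eq hD _ hc hkD, h1 u hc, h1 uᶜ hcc, hξ.subsetSum_compl,
        (hr hkD).neg_one_pow, hc, hcc, hkD]
      ring
    · rw [raise_mulVec_of_lt hD _ hc (by omega), h1 u hc, hc]
      push_cast
      rfl
  · rw [raise_mulVec_of_ne hD _ hu hc, weight, levelLift_mk_of_ne hD _ hu hc, mul_zero]

/-- For odd `r` the two parts of a level-`D` vertex contribute with opposite signs, so the string
ends at `D - 1`. -/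
theorem raise_mulVec_weight_of_odd (hD : 2 ≤ D) {r k : ℕ} {ξ : Vertex (2 * D) → ℂ}
    (hξ : IsLowest r fun u => ξ (mk u)) (hk : k + 1 = D) (hr : Odd r) :
    raise D k *ᵥ weight r k ξ = 0 := by
  ext x
  obtain ⟨u, hu, rfl⟩ := exists_mk_card_le x
  by_cases hc : u.card = k + 1
  · have h1 : ∀ v : Finset (Fin (2 * D)), v.card = k + 1 → ∑ a ∈ v, weight r k ξ (mk (v.erase a)) =
        ((v.card : ℂ) - r) * subsetSum r (fun u => ξ (mk u)) v := by
      intro v hv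
      rw [← sum_subsetSum_erase]
      refine sum_congr rfl fun a ha => weight_mk hD hξ (by omega) (by omega) ?_
      rw [card_erase_of_mem ha]
      omega
    have hcc : uᶜ.card = k + 1 := by
      rw [card_compl, Fintype.card_fin]
      omega
    rw [raise_mulVec_of_eq hD _ hc hk, h1 u hc, h1 uᶜ hcc, hξ.subsetSum_compl,
      hr.neg_one_pow, hc, hcc, Pi.zero_apply]
    ring
  · exact raise_mulVec_of_ne hD _ hu hc

theorem lower_mulVec_weight (hD : 2 ≤ D) {r k : ℕ} {ξ : Vertex (2 * D) → ℂ}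
    (hξ : IsLowest r fun u => ξ (mk u)) (hk : k < D) (hr : k + 1 = D → Even r) :
    lower D k *ᵥ weight r (k + 1) ξ = (2 * D - k - r : ℂ) • weight r k ξ := by
  ext x
  obtain ⟨u, hu, rfl⟩ := exists_mk_card_le x
  rw [Pi.smul_apply, smul_eq_mul]
  by_cases hc : u.card = k
  · have h := hξ.sum_subsetSum_insert u
    rw [Fintype.card_fin, hc] at h
    rw [lower_mulVec hD _ hc hk, weight_mk hD hξ hk.le (by omega) hc]
    push_cast at h
    rw [← h]
    refine sum_congr rfl fun a ha => weight_mk hD hξ hk hr ?_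
    rw [card_insert_of_notMem (mem_compl.1 ha), hc]
  · rw [lower_mulVec_of_ne hD _ hu hc, weight, levelLift_mk_of_ne hD _ hu hc, mul_zero]

theorem raise_mulVec_weight_of_ne {r k i : ℕ} (h : i ≠ k) (ξ : Vertex (2 * D) → ℂ) :
    raise D k *ᵥ weight r i ξ = 0 := by
  rw [raise, ← Matrix.mulVec_mulVec, dualIdempotent_mulVec_weight, if_neg h, Matrix.mulVec_zero]

theorem lower_mulVec_weight_of_ne {r k i : ℕ} (h : i ≠ k + 1) (ξ : Vertex (2 * D) → ℂ) :
    lower D k *ᵥ weight r i ξ = 0 := by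
  rw [lower, ← Matrix.mulVec_mulVec, dualIdempotent_mulVec_weight, if_neg h, Matrix.mulVec_zero]

/-! ### The columns of the transition matrix -/

theorem hasType_mk_iff (hD : 2 ≤ D) {i r : ℕ} (hr : r < D) {u v : Finset (Fin (2 * D))}
    (hi : i ≤ D) (hu : u.card = i) (hv : v.card = r) :
    HasType D i r r (mk u) (mk v) ↔ v ⊆ u ∨ (i = D ∧ v ⊆ uᶜ) := by
  have hcu := card_compl u
  have hcv := card_compl v
  rw [Fintype.card_fin] at hcu hcv
  constructor
  · rintro ⟨-, -, ⟨u', hu', v', hv', hu'c, hv'c, hc⟩, -⟩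
    have hvv : v' = v := by
      rcases mem_mk.1 hv' with h | h
      · exact h
      · rw [h] at hv'c
        omega
    subst hvv
    have hsub : v' ⊆ u' := by
      rw [← eq_of_subset_of_card_le (inter_subset_right : u' ∩ v' ⊆ v') (by omega)]
      exact inter_subset_left
    rcases mem_mk.1 hu' with rfl | rfl
    · exact Or.inl hsub
    · exact Or.inr ⟨by omega, hsub⟩
  · intro h
    refine ⟨by rw [dist_origin_of_card_le hD (by omega), hu],
      by rw [dist_origin_of_card_le hD (by omega), hv], ?_, ?_⟩
    · rcases h with h | ⟨h1, h2⟩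
      · exact ⟨u, mem_mk.2 (Or.inl rfl), v, mem_mk.2 (Or.inl rfl), hu, hv,
          by rw [inter_eq_right.2 h, hv]⟩
      · exact ⟨uᶜ, mem_mk.2 (Or.inr rfl), v, mem_mk.2 (Or.inl rfl), by omega, hv,
          by rw [inter_eq_right.2 h2, hv]⟩
    · rintro m ⟨u', -, v', -, -, hv', rfl⟩
      exact hv' ▸ card_le_card inter_subset_right

-- For `r < D` a vertex on level `r` has only one part of size `r`, so the level is indexed by
-- `r`-subsets.
open Classical in
theorem sum_level (hD : 2 ≤ D) {r : ℕ} (hr : r < D) (F : Vertex (2 * D) → ℂ)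
    (hF : ∀ y, (graph (2 * D)).dist (origin (2 * D)) y ≠ r → F y = 0) :
    ∑ y, F y = ∑ v ∈ univ.powersetCard r, F (mk v) := by
  rw [← sum_image (f := F) (g := mk)]
  · symm
    refine sum_subset (subset_univ _) fun y _ hy => hF y fun h => hy ?_
    obtain ⟨v, hv, rfl⟩ := exists_mk_card_le y
    rw [dist_origin_of_card_le hD hv] at h
    exact mem_image_of_mem _ (mem_powersetCard.2 ⟨subset_univ _, h⟩)
  · intro v hv w hw h
    have hv := (mem_powersetCard.1 hv).2
    have hw := (mem_powersetCard.1 hw).2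
    rcases mk_eq_mk.1 h with h | h
    · exact h
    · rw [h, card_compl, Fintype.card_fin] at hv
      omega

open Classical in
theorem orbitMatrix_mulVec (hD : 2 ≤ D) {i r : ℕ} (hr : r < D) (hi : i ≤ D)
    (ξ : Vertex (2 * D) → ℂ) {u : Finset (Fin (2 * D))} (hu : u.card = i) :
    (orbitMatrix D i r r *ᵥ ξ) (mk u) = ∑ v ∈ univ.powersetCard r,
      if v ⊆ u ∨ (i = D ∧ v ⊆ uᶜ) then ξ (mk v) else 0 := by
  rw [Matrix.mulVec, dotProduct, sum_level hD hr]
  · refine sum_congr rfl fun v hv => ?_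
    rw [orbitMatrix, Matrix.of_apply, ite_mul, one_mul, zero_mul]
    exact if_congr (hasType_mk_iff hD hr hi hu (mem_powersetCard.1 hv).2) rfl rfl
  · intro y hy
    rw [orbitMatrix, Matrix.of_apply, if_neg fun h => hy h.2.1, zero_mul]

theorem orbitMatrix_mulVec_of_ne (hD : 2 ≤ D) {i r : ℕ}
    (ξ : Vertex (2 * D) → ℂ) {u : Finset (Fin (2 * D))} (hu : u.card ≤ D) (h : u.card ≠ i) :
    (orbitMatrix D i r r *ᵥ ξ) (mk u) = 0 := by
  rw [Matrix.mulVec, dotProduct]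
  refine sum_eq_zero fun y _ => ?_
  rw [orbitMatrix, Matrix.of_apply, if_neg, zero_mul]
  intro h'
  have := h'.1
  rw [dist_origin_of_card_le hD hu] at this
  exact h this

theorem subsetSum_eq_sum_ite {α : Type*} [Fintype α] [DecidableEq α] (r : ℕ)
    (f : Finset α → ℂ) (u : Finset α) :
    subsetSum r f u = ∑ v ∈ univ.powersetCard r, if v ⊆ u then f v else 0 := by
  rw [← sum_filter, subsetSum]
  congr 1
  ext v
  simp [and_comm]

/-- At level `D` the matrix sums over `v` inside `u` or inside `uᶜ`. These two sums agree for even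
`r`, whence the factor `2`; for `r = 0` the only `v` is the empty set, which lies in both and is
counted once. -/
theorem orbitMatrix_mulVec_eq_weight (hD : 2 ≤ D) {i r : ℕ} (hr : r < D) (hi : i ≤ D)
    {ξ : Vertex (2 * D) → ℂ} (hξ : IsLowest r fun u => ξ (mk u)) (hir : i = D → Even r) :
    orbitMatrix D i r r *ᵥ ξ = (if i = D ∧ r ≠ 0 then 2 else 1 : ℂ) • weight r i ξ := by
  ext x
  obtain ⟨u, hu, rfl⟩ := exists_mk_card_le x
  rw [Pi.smul_apply, smul_eq_mul]
  by_cases hc : u.card = i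
  · rw [orbitMatrix_mulVec hD hr hi ξ hc, weight_mk hD hξ hi hir hc]
    by_cases hiD : i = D
    · by_cases hr0 : r = 0
      · subst hr0
        simp [subsetSum]
      · have h := hξ.subsetSum_compl u
        rw [(hir hiD).neg_one_pow, one_mul] at h
        rw [if_pos ⟨hiD, hr0⟩, two_mul (subsetSum _ _ _)]
        nth_rw 2 [← h]
        rw [subsetSum_eq_sum_ite, subsetSum_eq_sum_ite, ← sum_add_distrib]
        refine sum_congr rfl fun v hv => ?_
        have : ¬ (v ⊆ u ∧ v ⊆ uᶜ) := by
          rintro ⟨h1, h2⟩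
          have h3 : v ⊆ u ∩ uᶜ := subset_inter h1 h2
          rw [inter_compl, subset_empty] at h3
          rw [h3, mem_powersetCard, card_empty] at hv
          exact hr0 hv.2.symm
        by_cases h1 : v ⊆ u <;> by_cases h2 : v ⊆ uᶜ <;> simp_all
    · rw [if_neg (by simp [hiD]), one_mul, subsetSum_eq_sum_ite]
      simp [hiD]
  · rw [orbitMatrix_mulVec_of_ne hD ξ hu hc, weight, levelLift_mk_of_ne hD _ hu hc, mul_zero]

/-- The squared norm of `weight r i ξ` for a unit vector `ξ` of `L_r`. -/
def weightNormSq (D r i : ℕ) : ℝ :=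
  if i < D then (2 * D - 2 * r).choose (i - r) else
    if r = D then 1 else (2 * D - 2 * r).choose (D - r) / 2

theorem weightNormSq_pos {r i : ℕ} (hr : r ≤ i) (hi : i ≤ D) : 0 < weightNormSq D r i := by
  unfold weightNormSq
  split_ifs
  · exact_mod_cast Nat.choose_pos (by omega)
  · exact one_pos
  · refine half_pos ?_
    exact_mod_cast Nat.choose_pos (by omega)

/-- The case distinctions in `basisVector` all amount to dividing by the norm: at level `D`, the
constants `√2 / 2` with factor `2` and `√2` with factor `1` both match a squared norm of half a
binomial coefficient. -/
theorem basisVector_eq (hD : 2 ≤ D) {r i : ℕ} (hi : i ∈ levels D r)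
    {ξ : EuclideanSpace ℂ (Vertex (2 * D))} (hξ : ξ ∈ lowestSpace D r) :
    basisVector D r i ξ.ofLp = ((√(weightNormSq D r i))⁻¹ : ℂ) • weight r i ξ.ofLp := by
  obtain ⟨hri, hiD, hir⟩ := (mem_levels hD).1 hi
  have hlow := isLowest_of_mem hD (hri.trans hiD) hξ
  unfold basisVector weightNormSq
  by_cases h1 : i < D
  · rw [if_pos h1, if_pos h1, orbitMatrix_mulVec_eq_weight hD (by omega) hiD hlow hir,
      if_neg (by omega), one_smul]
    push_cast
    rfl
  · have hiD' : i = D := by omega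
    subst hiD'
    rw [if_neg h1, if_neg h1]
    by_cases h2 : r = i
    · subst h2
      rw [if_pos rfl, if_pos rfl, weight_self hD ((mem_lowestSpace_iff hD le_rfl ξ).1 hξ).2]
      simp
    · have h5 : (√2 : ℂ) * √2 = 2 := by
        rw [← Complex.ofReal_mul, Real.mul_self_sqrt (by norm_num)]
        norm_num
      have h6 : (√2 : ℂ) ≠ 0 := by
        intro h
        rw [h] at h5
        norm_num at h5
      rw [if_neg h2, if_neg h2, Real.sqrt_div (by positivity)]
      by_cases h3 : r = 0
      · subst h3
        rw [if_pos rfl, orbitMatrix_mulVec_eq_weight hD (by omega) hiD hlow hir, if_neg (by simp),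
          one_smul]
        congr 1
        simp [div_eq_mul_inv, mul_comm]
      · rw [if_neg h3, orbitMatrix_mulVec_eq_weight hD (by omega) hiD hlow hir,
          if_pos ⟨rfl, h3⟩, smul_smul]
        congr 1
        push_cast
        rw [inv_div]
        ring

/-! ### Orthogonality and completeness -/

theorem raiseCoeff_star (r k : ℕ) : star (raiseCoeff D r k) = raiseCoeff D r k := by
  unfold raiseCoeff
  split_ifs <;> simp

/-- Move the lowering matrix across the inner product, where it becomes raising. -/
theorem weight_dotProduct_succ (hD : 2 ≤ D) {r r' k : ℕ} {ξ η : Vertex (2 * D) → ℂ}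
    (hξ : IsLowest r fun u => ξ (mk u)) (hη : IsLowest r' fun u => η (mk u)) (hk : k < D)
    (hr : k + 1 = D → Even r) (hr' : k + 1 = D → Even r') :
    raiseCoeff D r k * (star (weight r (k + 1) ξ) ⬝ᵥ weight r' (k + 1) η) =
      (2 * D - k - r' : ℂ) * (star (weight r k ξ) ⬝ᵥ weight r' k η) := by
  have h := dotProduct_lower k (weight r k ξ) (weight r' (k + 1) η)
  rw [lower_mulVec_weight hD hη hk hr', raise_mulVec_weight hD hξ hk hr, star_smul,
    dotProduct_smul, smul_dotProduct, raiseCoeff_star] at h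
  exact h.symm

theorem weight_dotProduct_of_level_ne {r r' i i' : ℕ} (h : i ≠ i') (ξ η : Vertex (2 * D) → ℂ) :
    star (weight r i ξ) ⬝ᵥ weight r' i' η = 0 := by
  refine sum_eq_zero fun x _ => ?_
  rw [Pi.star_apply, weight, weight, levelLift, levelLift]
  split_ifs with h1 h2
  · exact absurd (h1.symm.trans h2) h
  all_goals simp

/-- Descend along the strings: below level `r'` the second vector is zero, and the raising
coefficients above are nonzero. -/
theorem weight_dotProduct_of_lt (hD : 2 ≤ D) {r r' i : ℕ} {ξ η : Vertex (2 * D) → ℂ}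
    (hξ : IsLowest r fun u => ξ (mk u)) (hη : IsLowest r' fun u => η (mk u)) (h : r < r')
    (hi : i ≤ D) (hr : i = D → Even r) (hr' : i = D → Even r') :
    star (weight r i ξ) ⬝ᵥ weight r' i η = 0 := by
  induction i with
  | zero => rw [weight_of_lt hD (by omega) η, dotProduct_zero]
  | succ i ih =>
    by_cases hlt : i + 1 < r'
    · rw [weight_of_lt hD hlt η, dotProduct_zero]
    · have h1 := weight_dotProduct_succ hD hξ hη hi hr hr'
      rw [ih (by omega) (by omega) (by omega), mul_zero] at h1
      exact (mul_eq_zero.1 h1).resolve_left (raiseCoeff_ne_zero (by omega))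

theorem weight_dotProduct_of_ne (hD : 2 ≤ D) {r r' i : ℕ} {ξ η : Vertex (2 * D) → ℂ}
    (hξ : IsLowest r fun u => ξ (mk u)) (hη : IsLowest r' fun u => η (mk u)) (h : r ≠ r')
    (hi : i ≤ D) (hr : i = D → Even r) (hr' : i = D → Even r') :
    star (weight r i ξ) ⬝ᵥ weight r' i η = 0 := by
  rcases h.lt_or_gt with h | h
  · exact weight_dotProduct_of_lt hD hξ hη h hi hr hr'
  · rw [Matrix.star_dotProduct, weight_dotProduct_of_lt hD hη hξ h hi hr' hr, star_zero]

/-- With `m = 2D - 2r` and `k = r + j` this is `(j+1) C(m, j+1) = (m-j) C(m, j)`. At level `D` the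
doubled coefficient compensates the halved norm. -/
theorem raiseCoeff_mul_weightNormSq {r k : ℕ} (hr : r ≤ k) (hk : k < D) :
    raiseCoeff D r k * weightNormSq D r (k + 1) = (2 * D - k - r : ℂ) * weightNormSq D r k := by
  obtain ⟨j, rfl⟩ := Nat.exists_eq_add_of_le hr
  have h := Nat.choose_succ_right_eq (2 * D - 2 * r) j
  rw [show 2 * D - 2 * r - j = 2 * D - (r + j) - r by omega] at h
  have h' := congrArg (Nat.cast : ℕ → ℂ) h
  push_cast [Nat.cast_sub (by omega : r ≤ 2 * D - (r + j)),
    Nat.cast_sub (by omega : r + j ≤ 2 * D)] at h'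
  unfold raiseCoeff weightNormSq
  rw [if_pos hk, Nat.add_sub_cancel_left]
  by_cases hkD : r + j + 1 = D
  · rw [if_pos hkD, if_neg (by omega), if_neg (by omega), show D - r = j + 1 by omega]
    have hD : (D : ℂ) = r + j + 1 := by exact_mod_cast hkD.symm
    push_cast
    rw [hD] at h' ⊢
    linear_combination h'
  · rw [if_neg hkD, if_pos (by omega), show r + j + 1 - r = j + 1 by omega]
    push_cast
    linear_combination h'

theorem weight_dotProduct_self (hD : 2 ≤ D) {r i : ℕ} (hi : i ∈ levels D r)
    {ξ η : EuclideanSpace ℂ (Vertex (2 * D))} (hξ : ξ ∈ lowestSpace D r)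
    (hη : η ∈ lowestSpace D r) :
    star (weight r i ξ.ofLp) ⬝ᵥ weight r i η.ofLp =
      weightNormSq D r i * (star ξ.ofLp ⬝ᵥ η.ofLp) := by
  obtain ⟨hri, hiD, hir⟩ := (mem_levels hD).1 hi
  have hrD := hri.trans hiD
  clear hi
  induction i, hri using Nat.le_induction with
  | base =>
    rw [weight_self hD ((mem_lowestSpace_iff hD hrD ξ).1 hξ).2,
      weight_self hD ((mem_lowestSpace_iff hD hrD η).1 hη).2]
    have : weightNormSq D r r = 1 := by
      unfold weightNormSq
      split_ifs
      · simp
      · rfl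
      · omega
    rw [this, Complex.ofReal_one, one_mul]
  | succ i hri ih =>
    have h1 := weight_dotProduct_succ hD (isLowest_of_mem hD hrD hξ) (isLowest_of_mem hD hrD hη)
      hiD hir hir
    rw [ih (by omega) (by omega), ← mul_assoc, ← raiseCoeff_mul_weightNormSq hri hiD,
      mul_assoc] at h1
    exact mul_left_cancel₀ (raiseCoeff_ne_zero (by omega)) h1

theorem weight_dotProduct (hD : 2 ≤ D) {r r' i i' : ℕ} (hi : i ∈ levels D r)
    (hi' : i' ∈ levels D r')
    {ξ η : EuclideanSpace ℂ (Vertex (2 * D))} (hξ : ξ ∈ lowestSpace D r)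
    (hη : η ∈ lowestSpace D r') :
    star (weight r i ξ.ofLp) ⬝ᵥ weight r' i' η.ofLp =
      if r = r' ∧ i = i' then weightNormSq D r i * (star ξ.ofLp ⬝ᵥ η.ofLp) else 0 := by
  by_cases hii : i = i'
  · subst hii
    by_cases hrr : r = r'
    · subst hrr
      rw [if_pos ⟨rfl, rfl⟩, weight_dotProduct_self hD hi hξ hη]
    · rw [if_neg (by simp [hrr])]
      obtain ⟨h1, h2, h3⟩ := (mem_levels hD).1 hi
      obtain ⟨h1', h2', h3'⟩ := (mem_levels hD).1 hi'
      exact weight_dotProduct_of_ne hD (isLowest_of_mem hD (h1.trans h2) hξ)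
        (isLowest_of_mem hD (h1'.trans h2) hη) hrr h2 h3 h3'
  · rw [if_neg (by simp [hii]), weight_dotProduct_of_level_ne hii]

theorem dualIdempotent_mulVec_idem (k : ℕ) (f : Vertex (2 * D) → ℂ) :
    dualIdempotent (graph (2 * D)) (origin (2 * D)) k *ᵥ
      (dualIdempotent (graph (2 * D)) (origin (2 * D)) k *ᵥ f) =
        dualIdempotent (graph (2 * D)) (origin (2 * D)) k *ᵥ f := by
  ext x
  simp only [dualIdempotent_mulVec]
  split_ifs <;> rfl

-- The level-`k` part `g` of `f` lies in `L_k`, so `f` is orthogonal to it; but `⟨g, f⟩ = ⟨g, g⟩`.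
open scoped ComplexOrder in
theorem dualIdempotent_mulVec_eq_zero_of_lower_eq_zero (hD : 2 ≤ D) {k : ℕ} (hk : k ≤ D)
    (f : Vertex (2 * D) → ℂ) (hlow : ∀ s, k = s + 1 → lower D s *ᵥ f = 0)
    (hf : ∀ ξ ∈ lowestSpace D k, star (weight k k ξ.ofLp) ⬝ᵥ f = 0) :
    dualIdempotent (graph (2 * D)) (origin (2 * D)) k *ᵥ f = 0 := by
  set g := dualIdempotent (graph (2 * D)) (origin (2 * D)) k *ᵥ f with hg
  have hgg : dualIdempotent (graph (2 * D)) (origin (2 * D)) k *ᵥ g = g :=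
    dualIdempotent_mulVec_idem k f
  have h := hf (WithLp.toLp 2 g) ((mem_lowestSpace_iff hD hk _).2
    ⟨fun s hs => by
      subst hs
      change lower D s *ᵥ g = 0
      rw [hg, lower_mulVec_dualIdempotent, hlow s rfl], hgg⟩)
  rw [weight_self hD hgg] at h
  rw [← dotProduct_star_self_eq_zero, ← h]
  calc star g ⬝ᵥ g
      = star (dualIdempotent (graph (2 * D)) (origin (2 * D)) k *ᵥ g) ⬝ᵥ f := by
        rw [Matrix.star_mulVec (dualIdempotent _ _ k) g, dualIdempotent_conjTranspose,
          ← Matrix.dotProduct_mulVec (star g) _ f, ← hg]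
    _ = star g ⬝ᵥ f := by rw [hgg]

/-- By adjointness the lowering of `f` is orthogonal to the strings on level `k`, since raising them
gives multiples of strings on level `k + 1`. By induction the lowering vanishes, and the previous
lemma applies. -/
theorem dualIdempotent_mulVec_eq_zero_of_orthogonal (hD : 2 ≤ D) (hDe : Even D) {k : ℕ}
    (hk : k ≤ D) (f : Vertex (2 * D) → ℂ)
    (hf : ∀ r, ∀ ξ ∈ lowestSpace D r, k ∈ levels D r → star (weight r k ξ.ofLp) ⬝ᵥ f = 0) :
    dualIdempotent (graph (2 * D)) (origin (2 * D)) k *ᵥ f = 0 := by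
  induction k generalizing f with
  | zero =>
    exact dualIdempotent_mulVec_eq_zero_of_lower_eq_zero hD hk f (fun s hs => absurd hs (by omega))
      fun ξ hξ => hf 0 ξ hξ ((mem_levels hD).2 (by simp))
  | succ k ih =>
    refine dualIdempotent_mulVec_eq_zero_of_lower_eq_zero hD hk f (fun s hs => ?_)
      -- The level `D` belongs to `N_D` only because `D` is even.
      fun ξ hξ => hf _ ξ hξ ((mem_levels hD).2 ⟨le_rfl, hk, fun h => h ▸ hDe⟩)
    obtain rfl : k = s := by omega
    rw [← dualIdempotent_mulVec_lower]
    refine ih (by omega) _ fun r ξ hξ hkr => ?_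
    obtain ⟨h1, h2, h3⟩ := (mem_levels hD).1 hkr
    have hlow := isLowest_of_mem hD (h1.trans h2) hξ
    rw [dotProduct_lower]
    by_cases hodd : k + 1 = D ∧ Odd r
    · rw [raise_mulVec_weight_of_odd hD hlow hodd.1 hodd.2, star_zero, zero_dotProduct]
    · have he : k + 1 = D → Even r := fun h => by
        rw [← Nat.not_odd_iff_even]
        exact fun ho => hodd ⟨h, ho⟩
      rw [raise_mulVec_weight hD hlow hk he, star_smul, smul_dotProduct,
        hf r ξ hξ ((mem_levels hD).2 ⟨by omega, hk, he⟩), smul_zero]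

theorem eq_zero_of_orthogonal (hD : 2 ≤ D) (hDe : Even D) (f : Vertex (2 * D) → ℂ)
    (hf : ∀ r, ∀ ξ ∈ lowestSpace D r, ∀ i ∈ levels D r, star (weight r i ξ.ofLp) ⬝ᵥ f = 0) :
    f = 0 := by
  ext x
  have h := congrFun (dualIdempotent_mulVec_eq_zero_of_orthogonal hD hDe
    (dist_le hD (origin (2 * D)) x) f fun r ξ hξ hi => hf r ξ hξ _ hi) x
  rwa [dualIdempotent_mulVec, if_pos rfl] at h

/-! ### Unitarity of the transition matrix -/

section Transition

variable {ι : Fin (D + 1) → Type*} [∀ r, Fintype (ι r)]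
  (b : ∀ r : Fin (D + 1), OrthonormalBasis (ι r) ℂ (lowestSpace D r))

theorem transition_conjTranspose_mulVec (hD : 2 ≤ D) (f : Vertex (2 * D) → ℂ)
    (p : Σ r : Fin (D + 1), ι r × levels D r) :
    ((transition D b)ᴴ *ᵥ f) p = ((√(weightNormSq D p.1 p.2.2))⁻¹ : ℂ) *
      (star (weight p.1 p.2.2 (b p.1 p.2.1 : EuclideanSpace ℂ (Vertex (2 * D))).ofLp) ⬝ᵥ f) := by
  have h : ((transition D b)ᴴ *ᵥ f) p = star (basisVector D p.1 p.2.2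
      (b p.1 p.2.1 : EuclideanSpace ℂ (Vertex (2 * D))).ofLp) ⬝ᵥ f := rfl
  rw [h, basisVector_eq hD p.2.2.2 (b p.1 p.2.1).2, star_smul, smul_dotProduct, smul_eq_mul]
  congr 1
  simp

theorem transition_conjTranspose_mul_self [∀ r, DecidableEq (ι r)] (hD : 2 ≤ D) :
    (transition D b)ᴴ * transition D b = 1 := by
  ext p q
  have h : ((transition D b)ᴴ * transition D b) p q = ((transition D b)ᴴ *ᵥ basisVector D q.1 q.2.2
      (b q.1 q.2.1 : EuclideanSpace ℂ (Vertex (2 * D))).ofLp) p := rfl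
  rw [h, transition_conjTranspose_mulVec b hD, basisVector_eq hD q.2.2.2 (b q.1 q.2.1).2,
    dotProduct_smul, weight_dotProduct hD p.2.2.2 q.2.2.2 (b p.1 p.2.1).2 (b q.1 q.2.1).2,
    smul_eq_mul]
  obtain ⟨r, k, i⟩ := p
  obtain ⟨r', l, j⟩ := q
  by_cases hr : r = r'
  · subst hr
    by_cases hi : i = j
    · subst hi
      have ho := orthonormal_iff_ite.1 (b r).orthonormal k l
      rw [Submodule.coe_inner, EuclideanSpace.inner_eq_star_dotProduct, dotProduct_comm] at ho
      rw [if_pos ⟨rfl, rfl⟩]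
      dsimp only
      rw [ho]
      obtain ⟨h1, h2, -⟩ := (mem_levels hD).1 i.2
      have hpos := weightNormSq_pos h1 h2
      have hs : (√(weightNormSq D r i) : ℂ) * √(weightNormSq D r i) = weightNormSq D r i := by
        rw [← Complex.ofReal_mul, Real.mul_self_sqrt hpos.le]
      have hs0 : (√(weightNormSq D r i) : ℂ) ≠ 0 := by
        exact_mod_cast (Real.sqrt_pos.2 hpos).ne'
      by_cases hkl : k = l
      · subst hkl
        rw [if_pos rfl, Matrix.one_apply_eq, ← hs]
        field_simp
      · rw [if_neg hkl, Matrix.one_apply_ne (by simp [hkl])]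
        simp
    · have : (i : ℕ) ≠ j := fun h => hi (Subtype.ext h)
      rw [if_neg (by simp [this]), Matrix.one_apply_ne (by simp [hi])]
      simp
  · have : (r : ℕ) ≠ r' := fun h => hr (Fin.ext h)
    rw [if_neg (by simp [this]), Matrix.one_apply_ne (by simp [hr])]
    simp

theorem eq_zero_of_transition_conjTranspose_mulVec (hD : 2 ≤ D) (hDe : Even D)
    (f : Vertex (2 * D) → ℂ) (hf : (transition D b)ᴴ *ᵥ f = 0) : f = 0 := by
  refine eq_zero_of_orthogonal hD hDe f fun r ξ hξ i hi => ?_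
  obtain ⟨h1, h2, -⟩ := (mem_levels hD).1 hi
  let r' : Fin (D + 1) := ⟨r, by omega⟩
  -- The hypothesis covers only basis vectors. With `f` in the conjugated slot the pairing is linear
  -- in `η`, so it vanishes on all of `L_r`.
  let F : lowestSpace D r →ₗ[ℂ] ℂ :=
    { toFun := fun η => star f ⬝ᵥ weight r i (η : EuclideanSpace ℂ (Vertex (2 * D))).ofLp
      map_add' := fun η ζ => by
        rw [Submodule.coe_add, WithLp.ofLp_add, weight_add, dotProduct_add]
      map_smul' := fun c η => by
        rw [Submodule.coe_smul, WithLp.ofLp_smul, weight_smul, dotProduct_smul]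
        rfl }
  have hF : F = 0 := by
    refine (b r').toBasis.ext fun k => ?_
    have h3 := congrFun hf ⟨r', k, ⟨i, hi⟩⟩
    rw [transition_conjTranspose_mulVec b hD, Pi.zero_apply] at h3
    have hs0 : (√(weightNormSq D r i) : ℂ) ≠ 0 := by
      exact_mod_cast (Real.sqrt_pos.2 (weightNormSq_pos h1 h2)).ne'
    have h4 := (mul_eq_zero.1 h3).resolve_left (inv_ne_zero hs0)
    rw [Matrix.star_dotProduct, star_eq_zero] at h4
    rw [OrthonormalBasis.coe_toBasis]
    exact h4
  have h5 := LinearMap.congr_fun hF ⟨ξ, hξ⟩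
  rw [Matrix.star_dotProduct, star_eq_zero]
  exact h5

/-- No dimension count is needed: `U*(UU* - 1) = 0` follows from `U*U = 1`, and `U*` is injective by
completeness. -/
theorem transition_mul_conjTranspose [∀ r, DecidableEq (ι r)] (hD : 2 ≤ D) (hDe : Even D) :
    transition D b * (transition D b)ᴴ = 1 := by
  refine Matrix.ext_of_mulVec_single fun x => ?_
  rw [← sub_eq_zero, ← Matrix.sub_mulVec]
  apply eq_zero_of_transition_conjTranspose_mulVec b hD hDe
  rw [Matrix.mulVec_mulVec, Matrix.mul_sub, ← Matrix.mul_assoc,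
    transition_conjTranspose_mul_self b hD, Matrix.one_mul, Matrix.mul_one, sub_self,
    Matrix.zero_mulVec]

end Transition

/-! ### Matrices acting blockwise -/

/-- The algebra `⨁ᵣ ℂ^{N_r × N_r}`. -/
abbrev BlockAlgebra (D : ℕ) : Type :=
  ∀ r : Fin (D + 1), Matrix (levels D r) (levels D r) ℂ

/-- The matrix `A` acts on the columns of the transition matrix by the blocks of `B`. -/
def ActsBy (A : Matrix (Vertex (2 * D)) (Vertex (2 * D)) ℂ) (B : BlockAlgebra D) : Prop :=
  ∀ r : Fin (D + 1), ∀ ξ ∈ lowestSpace D r, ∀ j : levels D r,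
    A *ᵥ basisVector D r j ξ.ofLp = ∑ i, B r i j • basisVector D r i ξ.ofLp

theorem ActsBy.add {A A' : Matrix (Vertex (2 * D)) (Vertex (2 * D)) ℂ} {B B' : BlockAlgebra D}
    (h : ActsBy A B) (h' : ActsBy A' B') : ActsBy (A + A') (B + B') := by
  intro r ξ hξ j
  rw [Matrix.add_mulVec, h r ξ hξ j, h' r ξ hξ j, ← sum_add_distrib]
  exact sum_congr rfl fun i _ => (add_smul _ _ _).symm

theorem ActsBy.mul {A A' : Matrix (Vertex (2 * D)) (Vertex (2 * D)) ℂ} {B B' : BlockAlgebra D}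
    (h : ActsBy A B) (h' : ActsBy A' B') : ActsBy (A * A') (B * B') := by
  intro r ξ hξ j
  rw [← Matrix.mulVec_mulVec, h' r ξ hξ j, Matrix.mulVec_sum]
  simp_rw [Matrix.mulVec_smul, h r ξ hξ, smul_sum]
  rw [sum_comm]
  refine sum_congr rfl fun i _ => ?_
  rw [Pi.mul_apply, Matrix.mul_apply, sum_smul]
  exact sum_congr rfl fun k _ => by rw [smul_smul, mul_comm (B' r k j)]

theorem ActsBy.algebraMap (c : ℂ) :
    ActsBy (algebraMap ℂ (Matrix (Vertex (2 * D)) (Vertex (2 * D)) ℂ) c)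
      (algebraMap ℂ (BlockAlgebra D) c) := by
  intro r ξ hξ j
  rw [Algebra.algebraMap_eq_smul_one, Matrix.smul_mulVec, Matrix.one_mulVec,
    sum_eq_single j]
  · simp [Matrix.algebraMap_matrix_apply]
  · intro i _ hij
    simp [Matrix.algebraMap_matrix_apply, hij]
  · simp

/-- Normalizing the vectors conjugates each block by the diagonal matrix of their norms. -/
theorem actsBy_of_weight (hD : 2 ≤ D) {A : Matrix (Vertex (2 * D)) (Vertex (2 * D)) ℂ}
    (C : BlockAlgebra D)
    (h : ∀ r : Fin (D + 1), ∀ ξ ∈ lowestSpace D r, ∀ j : levels D r,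
      A *ᵥ weight r j ξ.ofLp = ∑ i, C r i j • weight r i ξ.ofLp) :
    ActsBy A fun r => Matrix.of fun i j =>
      C r i j * (√(weightNormSq D r i) / √(weightNormSq D r j)) := by
  intro r ξ hξ j
  rw [basisVector_eq hD j.2 hξ, Matrix.mulVec_smul, h r ξ hξ j, smul_sum]
  refine sum_congr rfl fun i _ => ?_
  obtain ⟨h1, h2, -⟩ := (mem_levels hD).1 i.2
  have hs0 : (√(weightNormSq D r i) : ℂ) ≠ 0 := by
    exact_mod_cast (Real.sqrt_pos.2 (weightNormSq_pos h1 h2)).ne'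
  rw [basisVector_eq hD i.2 hξ, smul_smul, smul_smul]
  simp only [Matrix.of_apply]
  congr 1
  field_simp

/-- The target level and the scalar are chosen before `ξ`; this uniformity is what makes all copies
of a block equal. -/
theorem exists_actsBy_of_weight (hD : 2 ≤ D) {A : Matrix (Vertex (2 * D)) (Vertex (2 * D)) ℂ}
    (h : ∀ r : Fin (D + 1), ∀ j : levels D r, ∃ (i : levels D r) (c : ℂ),
      ∀ ξ ∈ lowestSpace D r, A *ᵥ weight r j ξ.ofLp = c • weight r i ξ.ofLp) :
    ∃ B, ActsBy A B := by
  choose k c hc using h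
  refine ⟨_, actsBy_of_weight hD
    (fun r => Matrix.of fun i j => if i = k r j then c r j else 0) fun r ξ hξ j => ?_⟩
  rw [hc r j ξ hξ]
  simp [ite_smul]

theorem exists_actsBy_dualIdempotent (hD : 2 ≤ D) (k : ℕ) :
    ∃ B, ActsBy (dualIdempotent (graph (2 * D)) (origin (2 * D)) k) B := by
  refine exists_actsBy_of_weight hD fun r j => ⟨j, if (j : ℕ) = k then 1 else 0, fun ξ _ => ?_⟩
  rw [dualIdempotent_mulVec_weight]
  split_ifs <;> simp

theorem exists_actsBy_raise (hD : 2 ≤ D) {k : ℕ} (hk : k < D) : ∃ B, ActsBy (raise D k) B := by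
  refine exists_actsBy_of_weight hD fun r j => ?_
  have hr : (r : ℕ) ≤ D := by omega
  by_cases hjk : (j : ℕ) = k
  · obtain ⟨h1, h2, h3⟩ := (mem_levels hD).1 j.2
    by_cases hodd : k + 1 = D ∧ Odd (r : ℕ)
    · refine ⟨j, 0, fun ξ hξ => ?_⟩
      rw [hjk, raise_mulVec_weight_of_odd hD (isLowest_of_mem hD hr hξ) hodd.1 hodd.2, zero_smul]
    · have he : k + 1 = D → Even (r : ℕ) := fun h => by
        rw [← Nat.not_odd_iff_even]
        exact fun ho => hodd ⟨h, ho⟩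
      refine ⟨⟨k + 1, (mem_levels hD).2 ⟨by omega, hk, he⟩⟩, raiseCoeff D r k, fun ξ hξ => ?_⟩
      rw [hjk, raise_mulVec_weight hD (isLowest_of_mem hD hr hξ) hk he]
  · refine ⟨j, 0, fun ξ _ => ?_⟩
    rw [raise_mulVec_weight_of_ne hjk, zero_smul]

theorem exists_actsBy_lower (hD : 2 ≤ D) {k : ℕ} (hk : k < D) : ∃ B, ActsBy (lower D k) B := by
  refine exists_actsBy_of_weight hD fun r j => ?_
  have hr : (r : ℕ) ≤ D := by omega
  by_cases hjk : (j : ℕ) = k + 1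
  · obtain ⟨h1, h2, h3⟩ := (mem_levels hD).1 j.2
    rw [hjk] at h1 h3 ⊢
    by_cases hkr : k < r
    · refine ⟨j, 0, fun ξ hξ => ?_⟩
      rw [lower_mulVec_weight hD (isLowest_of_mem hD hr hξ) hk h3, weight_of_lt hD hkr,
        smul_zero, zero_smul]
    · refine ⟨⟨k, (mem_levels hD).2 ⟨by omega, hk.le, by omega⟩⟩, 2 * D - k - r, fun ξ hξ => ?_⟩
      rw [lower_mulVec_weight hD (isLowest_of_mem hD hr hξ) hk h3]
  · refine ⟨j, 0, fun ξ _ => ?_⟩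
    rw [lower_mulVec_weight_of_ne hjk, zero_smul]

theorem exists_actsBy_distanceMatrix_one (hD : 2 ≤ D) :
    ∃ B, ActsBy (distanceMatrix (graph (2 * D)) 1) B := by
  rw [distanceMatrix_one_eq_sum hD]
  refine sum_induction _ (fun A => ∃ B, ActsBy A B) ?_ ?_ fun k hk => ?_
  · rintro _ _ ⟨B, h⟩ ⟨B', h'⟩
    exact ⟨_, h.add h'⟩
  · have h := ActsBy.algebraMap (D := D) 0
    rw [map_zero] at h
    exact ⟨_, h⟩
  · obtain ⟨B, h⟩ := exists_actsBy_raise hD (mem_range.1 hk)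
    obtain ⟨B', h'⟩ := exists_actsBy_lower hD (mem_range.1 hk)
    exact ⟨_, h.add h'⟩

theorem terwilligerAlgebra_le (hD : 2 ≤ D) :
    terwilligerAlgebra (graph (2 * D)) (origin (2 * D)) ≤
      Algebra.adjoin ℂ ({distanceMatrix (graph (2 * D)) 1} ∪
        Set.range (dualIdempotent (graph (2 * D)) (origin (2 * D)))) := by
  refine Algebra.adjoin_le (Set.union_subset ?_ ?_)
  · rintro _ ⟨k, rfl⟩
    exact Algebra.adjoin_mono Set.subset_union_left (distanceMatrix_mem_adjoin hD k)
  · exact Set.subset_union_right.trans Algebra.subset_adjoin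

theorem exists_actsBy (hD : 2 ≤ D) {A : Matrix (Vertex (2 * D)) (Vertex (2 * D)) ℂ}
    (hA : A ∈ terwilligerAlgebra (graph (2 * D)) (origin (2 * D))) : ∃ B, ActsBy A B := by
  have hA' := terwilligerAlgebra_le hD hA
  clear hA
  induction hA' using Algebra.adjoin_induction with
  | mem A h =>
    rcases h with rfl | ⟨k, rfl⟩
    · exact exists_actsBy_distanceMatrix_one hD
    · exact exists_actsBy_dualIdempotent hD k
  | algebraMap c => exact ⟨_, ActsBy.algebraMap c⟩
  | add A A' _ _ h h' =>
    obtain ⟨B, h⟩ := h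
    obtain ⟨B', h'⟩ := h'
    exact ⟨_, h.add h'⟩
  | mul A A' _ _ h h' =>
    obtain ⟨B, h⟩ := h
    obtain ⟨B', h'⟩ := h'
    exact ⟨_, h.mul h'⟩

/-! ### Matrix units in the Terwilliger algebra -/

/-- The matrix `A` takes `weight r j ξ` to `weight r i ξ` and annihilates all other weight
vectors. -/
def IsMatrixUnit (r i j : ℕ) (A : Matrix (Vertex (2 * D)) (Vertex (2 * D)) ℂ) : Prop :=
  ∀ s ≤ D, ∀ ξ ∈ lowestSpace D s, ∀ k ∈ levels D s,
    A *ᵥ weight s k ξ.ofLp = if s = r ∧ k = j then weight r i ξ.ofLp else 0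

theorem dualIdempotent_mem (k : ℕ) : dualIdempotent (graph (2 * D)) (origin (2 * D)) k ∈
    terwilligerAlgebra (graph (2 * D)) (origin (2 * D)) :=
  Algebra.subset_adjoin (Or.inr ⟨k, rfl⟩)

theorem raise_mem (k : ℕ) : raise D k ∈ terwilligerAlgebra (graph (2 * D)) (origin (2 * D)) :=
  mul_mem (mul_mem (dualIdempotent_mem _) (Algebra.subset_adjoin (Or.inl ⟨1, rfl⟩)))
    (dualIdempotent_mem _)

theorem lower_mem (k : ℕ) : lower D k ∈ terwilligerAlgebra (graph (2 * D)) (origin (2 * D)) :=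
  mul_mem (mul_mem (dualIdempotent_mem _) (Algebra.subset_adjoin (Or.inl ⟨1, rfl⟩)))
    (dualIdempotent_mem _)

/-- Multiplying by raising matrices on the left moves the row index up from `r`; multiplying by
lowering matrices on the right moves the column index up. The coefficients divided out are nonzero.
-/
theorem exists_isMatrixUnit_of_self (hD : 2 ≤ D) {r : ℕ}
    (h : ∃ A ∈ terwilligerAlgebra (graph (2 * D)) (origin (2 * D)), IsMatrixUnit r r r A)
    {i j : ℕ} (hi : i ∈ levels D r) (hj : j ∈ levels D r) :
    ∃ A ∈ terwilligerAlgebra (graph (2 * D)) (origin (2 * D)), IsMatrixUnit r i j A := by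
  obtain ⟨hri, hiD, hir⟩ := (mem_levels hD).1 hi
  obtain ⟨hrj, hjD, hjr⟩ := (mem_levels hD).1 hj
  have hrD := hri.trans hiD
  have h1 : ∃ A ∈ terwilligerAlgebra (graph (2 * D)) (origin (2 * D)), IsMatrixUnit r i r A := by
    clear hi
    induction i, hri using Nat.le_induction with
    | base => exact h
    | succ i hri ih =>
      obtain ⟨A, hA, hu⟩ := ih (by omega) (by omega)
      have hne := raiseCoeff_ne_zero (D := D) (by omega : r < i + 1)
      refine ⟨(raiseCoeff D r i)⁻¹ • (raise D i * A),
        Subalgebra.smul_mem _ (mul_mem (raise_mem i) hA) _, fun s hs ξ hξ k hk => ?_⟩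
      rw [Matrix.smul_mulVec, ← Matrix.mulVec_mulVec, hu s hs ξ hξ k hk]
      split_ifs with hsk
      · obtain ⟨rfl, -⟩ := hsk
        rw [raise_mulVec_weight hD (isLowest_of_mem hD hs hξ) hiD hir, inv_smul_smul₀ hne]
      · rw [Matrix.mulVec_zero, smul_zero]
  clear hj
  induction j, hrj using Nat.le_induction with
  | base => exact h1
  | succ j hrj ih =>
    obtain ⟨A, hA, hu⟩ := ih (by omega) (by omega)
    have hne : (2 * D - j - r : ℂ) ≠ 0 := by
      intro h0
      have h2 : ((2 * D : ℕ) : ℂ) = (j + r : ℕ) := by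
        push_cast
        linear_combination h0
      have := Nat.cast_injective h2
      omega
    refine ⟨(2 * D - j - r : ℂ)⁻¹ • (A * lower D j),
      Subalgebra.smul_mem _ (mul_mem hA (lower_mem j)) _, fun s hs ξ hξ k hk => ?_⟩
    rw [Matrix.smul_mulVec, ← Matrix.mulVec_mulVec]
    obtain ⟨hsk, hkD, hks⟩ := (mem_levels hD).1 hk
    by_cases hkj : k = j + 1
    · subst hkj
      rw [lower_mulVec_weight hD (isLowest_of_mem hD hs hξ) hjD hks, Matrix.mulVec_smul]
      by_cases hsj : s ≤ j
      · rw [hu s hs ξ hξ j ((mem_levels hD).2 ⟨hsj, by omega, by omega⟩)]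
        by_cases hsr : s = r
        · subst hsr
          rw [if_pos ⟨rfl, rfl⟩, if_pos ⟨rfl, rfl⟩, inv_smul_smul₀ hne]
        · rw [if_neg (by simp [hsr]), if_neg (by simp [hsr]), smul_zero, smul_zero]
      -- Here `s = j + 1` is the bottom of its string, so lowering gives zero; and `s ≠ r` as `r ≤
      -- j`.
      · rw [weight_of_lt hD (by omega), Matrix.mulVec_zero, smul_zero, smul_zero,
          if_neg (by omega)]
    · rw [lower_mulVec_weight_of_ne hkj, Matrix.mulVec_zero, smul_zero, if_neg (by simp [hkj])]

/-- The dual idempotent of level `r` is the identity on the strings through that level, and these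
start at some `s ≤ r`. Subtracting the matrix units of the strings with `s < r`, available by
induction, leaves the one starting at `r`. -/
theorem exists_isMatrixUnit_self (hD : 2 ≤ D) {r : ℕ} (hr : r ≤ D) :
    ∃ A ∈ terwilligerAlgebra (graph (2 * D)) (origin (2 * D)), IsMatrixUnit r r r A := by
  induction r using Nat.strong_induction_on with
  | _ r ih =>
    have h : ∀ s : {s // s ∈ range r ∧ r ∈ levels D s},
        ∃ A ∈ terwilligerAlgebra (graph (2 * D)) (origin (2 * D)), IsMatrixUnit s.1 r r A :=
      fun s => exists_isMatrixUnit_of_self hD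
        (ih s (mem_range.1 s.2.1) ((mem_range.1 s.2.1).le.trans hr)) s.2.2 s.2.2
    choose U hU hu using h
    let W : ℕ → Matrix (Vertex (2 * D)) (Vertex (2 * D)) ℂ := fun s =>
      if hs : s ∈ range r ∧ r ∈ levels D s then U ⟨s, hs⟩ else 0
    refine ⟨dualIdempotent (graph (2 * D)) (origin (2 * D)) r - ∑ s ∈ range r, W s,
      sub_mem (dualIdempotent_mem r) (sum_mem fun s _ => ?_), fun s hs ξ hξ k hk => ?_⟩
    · simp only [W]
      split_ifs
      · exact hU _
      · exact zero_mem _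
    · have hW : ∀ t ∈ range r, W t *ᵥ weight s k ξ.ofLp =
          if s = t ∧ k = r then weight s r ξ.ofLp else 0 := by
        intro t ht
        simp only [W]
        by_cases h1 : t ∈ range r ∧ r ∈ levels D t
        · rw [dif_pos h1, hu ⟨t, h1⟩ s hs ξ hξ k hk]
          split_ifs with h2
          · rw [h2.1]
          · rfl
        · rw [dif_neg h1, Matrix.zero_mulVec, if_neg]
          rintro ⟨rfl, rfl⟩
          exact h1 ⟨ht, hk⟩
      rw [Matrix.sub_mulVec, Matrix.sum_mulVec, sum_congr rfl hW, dualIdempotent_mulVec_weight]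
      by_cases hkr : k = r
      · subst hkr
        have hsk := ((mem_levels hD).1 hk).1
        rcases hsk.eq_or_lt with rfl | hlt
        · rw [if_pos rfl, if_pos ⟨rfl, rfl⟩, sum_eq_zero, sub_zero]
          intro t ht
          rw [mem_range] at ht
          rw [if_neg (by omega)]
        · rw [if_pos rfl, if_neg (by omega), sum_eq_single s, if_pos ⟨rfl, rfl⟩, sub_self]
          · intro t _ hts
            rw [if_neg (by simp [hts.symm])]
          · intro h1
            exact absurd (mem_range.2 hlt) h1
      · simp [hkr]

theorem exists_mem_actsBy (hD : 2 ≤ D) (B : BlockAlgebra D) :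
    ∃ A ∈ terwilligerAlgebra (graph (2 * D)) (origin (2 * D)), ActsBy A B := by
  have h : ∀ (r : Fin (D + 1)) (i j : levels D r),
      ∃ A ∈ terwilligerAlgebra (graph (2 * D)) (origin (2 * D)), IsMatrixUnit r i j A :=
    fun r i j => exists_isMatrixUnit_of_self hD (exists_isMatrixUnit_self hD (by omega)) i.2 j.2
  choose U hU hu using h
  -- The entries of `B` with the normalization of `actsBy_of_weight` undone.
  let C : BlockAlgebra D := fun r => Matrix.of fun i j =>
    B r i j * (√(weightNormSq D r j) / √(weightNormSq D r i))
  refine ⟨∑ r, ∑ i, ∑ j, C r i j • U r i j, sum_mem fun r _ => sum_mem fun i _ =>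
    sum_mem fun j _ => Subalgebra.smul_mem _ (hU r i j) _, ?_⟩
  have key := actsBy_of_weight (A := ∑ r, ∑ i, ∑ j, C r i j • U r i j) hD C ?_
  · convert key using 1
    ext r i j
    have hs0 : ∀ k : levels D r, (√(weightNormSq D r k) : ℂ) ≠ 0 := by
      intro k
      obtain ⟨h1, h2, -⟩ := (mem_levels hD).1 k.2
      exact_mod_cast (Real.sqrt_pos.2 (weightNormSq_pos h1 h2)).ne'
    have h1 := hs0 i
    have h2 := hs0 j
    simp only [C, Matrix.of_apply]
    field_simp
  · intro r ξ hξ j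
    simp only [Matrix.sum_mulVec, Matrix.smul_mulVec]
    rw [sum_eq_single r]
    · refine sum_congr rfl fun i _ => ?_
      rw [sum_eq_single j]
      · rw [hu r i j r (by omega) ξ hξ j j.2, if_pos ⟨rfl, rfl⟩]
      · intro k _ hk
        rw [hu r i k r (by omega) ξ hξ j j.2, if_neg, smul_zero]
        rintro ⟨-, h⟩
        exact hk (Subtype.ext h.symm)
      · simp
    · intro s _ hs
      refine sum_eq_zero fun i _ => sum_eq_zero fun k _ => ?_
      rw [hu s i k r (by omega) ξ hξ j j.2, if_neg, smul_zero]
      rintro ⟨h, -⟩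
      exact hs (Fin.ext h.symm)
    · simp

/-! ### Block diagonalization -/

theorem ActsBy.transition_conj (hD : 2 ≤ D) {A : Matrix (Vertex (2 * D)) (Vertex (2 * D)) ℂ}
    {B : BlockAlgebra D} (h : ActsBy A B) {ι : Fin (D + 1) → Type*} [∀ r, Fintype (ι r)]
    [∀ r, DecidableEq (ι r)]
    (b : ∀ r : Fin (D + 1), OrthonormalBasis (ι r) ℂ (lowestSpace D r)) :
    (transition D b)ᴴ * A * transition D b =
      Matrix.blockDiagonal' fun r => (1 : Matrix (ι r) (ι r) ℂ) ⊗ₖ B r := by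
  have key : A * transition D b = transition D b *
      Matrix.blockDiagonal' fun r => (1 : Matrix (ι r) (ι r) ℂ) ⊗ₖ B r := by
    ext x ⟨r, k, j⟩
    have h1 : (A * transition D b) x ⟨r, k, j⟩ = (A *ᵥ basisVector D r j
        (b r k : EuclideanSpace ℂ (Vertex (2 * D))).ofLp) x := rfl
    rw [h1, h r _ (b r k).2 j, Finset.sum_apply, Matrix.mul_apply, Fintype.sum_sigma,
      sum_eq_single r, Fintype.sum_prod_type, sum_eq_single k]
    · refine sum_congr rfl fun i _ => ?_
      rw [Matrix.blockDiagonal'_apply_eq, Matrix.kroneckerMap_apply, Matrix.one_apply_eq, one_mul,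
        Pi.smul_apply, smul_eq_mul, mul_comm]
      rfl
    · intro l _ hl
      refine sum_eq_zero fun i _ => ?_
      rw [Matrix.blockDiagonal'_apply_eq, Matrix.kroneckerMap_apply, Matrix.one_apply_ne hl,
        zero_mul, mul_zero]
    · simp
    · intro s _ hs
      refine sum_eq_zero fun p _ => ?_
      rw [Matrix.blockDiagonal'_apply_ne _ _ _ hs, mul_zero]
    · simp
  rw [Matrix.mul_assoc, key, ← Matrix.mul_assoc, transition_conjTranspose_mul_self b hD,
    Matrix.one_mul]

theorem ActsBy.left_unique (hD : 2 ≤ D) (hDe : Even D)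
    {A A' : Matrix (Vertex (2 * D)) (Vertex (2 * D)) ℂ} {B : BlockAlgebra D}
    (h : ActsBy A B) (h' : ActsBy A' B) : A = A' := by
  let b := fun r : Fin (D + 1) => stdOrthonormalBasis ℂ (lowestSpace D r)
  have e := (h.transition_conj hD b).trans (h'.transition_conj hD b).symm
  have hU := transition_mul_conjTranspose b hD hDe
  have key : ∀ M : Matrix (Vertex (2 * D)) (Vertex (2 * D)) ℂ,
      transition D b * ((transition D b)ᴴ * M * transition D b) * (transition D b)ᴴ = M := by
    intro M
    rw [Matrix.mul_assoc, Matrix.mul_assoc _ (transition D b), hU, Matrix.mul_one,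
      ← Matrix.mul_assoc, hU, Matrix.one_mul]
  rw [← key A, e, key]

/-- Since `L_r ≠ 0`, an orthonormal basis has a first vector, and the block can be read off from its
copy. -/
theorem ActsBy.right_unique (hD : 2 ≤ D) (hDe : Even D)
    {A : Matrix (Vertex (2 * D)) (Vertex (2 * D)) ℂ} {B B' : BlockAlgebra D}
    (h : ActsBy A B) (h' : ActsBy A B') : B = B' := by
  let b := fun r : Fin (D + 1) => stdOrthonormalBasis ℂ (lowestSpace D r)
  have e := (h.transition_conj hD b).symm.trans (h'.transition_conj hD b)
  ext r i j
  obtain ⟨ξ, hξ, hne⟩ := exists_mem_lowestSpace_ne_zero hD hDe (by omega : (r : ℕ) ≤ D)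
  have : Nontrivial (lowestSpace D r) :=
    ⟨⟨ξ, hξ⟩, 0, fun h => hne (congrArg Subtype.val h)⟩
  have e1 := congrFun (congrFun e ⟨r, ⟨0, Module.finrank_pos⟩, i⟩) ⟨r, ⟨0, Module.finrank_pos⟩, j⟩
  simpa [Matrix.blockDiagonal'_apply_eq, Matrix.kroneckerMap_apply] using e1

/-- The graph of the isomorphism between the Terwilliger algebra and the block algebra. -/
def actsBySubalgebra (D : ℕ) :
    Subalgebra ℂ (terwilligerAlgebra (graph (2 * D)) (origin (2 * D)) × BlockAlgebra D) where
  carrier := {p | ActsBy p.1.1 p.2}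
  mul_mem' h h' := h.mul h'
  add_mem' h h' := h.add h'
  algebraMap_mem' c := ActsBy.algebraMap c

/-- The relation `ActsBy` is a subalgebra of the product, and both projections from it are
bijective. It quantifies over all of `L_r`, so the isomorphism involves no choice of bases. -/
theorem exists_algEquiv (hD : 2 ≤ D) (hDe : Even D) :
    ∃ Φ : terwilligerAlgebra (graph (2 * D)) (origin (2 * D)) ≃ₐ[ℂ] BlockAlgebra D,
      ∀ A, ActsBy A.1 (Φ A) := by
  let f := (AlgHom.fst ℂ (terwilligerAlgebra (graph (2 * D)) (origin (2 * D)))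
    (BlockAlgebra D)).comp (actsBySubalgebra D).val
  let g := (AlgHom.snd ℂ (terwilligerAlgebra (graph (2 * D)) (origin (2 * D)))
    (BlockAlgebra D)).comp (actsBySubalgebra D).val
  have hf : Function.Bijective f := by
    constructor
    · rintro ⟨⟨A, B⟩, h⟩ ⟨⟨A', B'⟩, h'⟩ (rfl : A = A')
      obtain rfl := ActsBy.right_unique hD hDe h h'
      rfl
    · intro A
      obtain ⟨B, h⟩ := exists_actsBy hD A.2
      exact ⟨⟨(A, B), h⟩, rfl⟩
  have hg : Function.Bijective g := by
    constructor
    · rintro ⟨⟨A, B⟩, h⟩ ⟨⟨A', B'⟩, h'⟩ (rfl : B = B')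
      obtain rfl := Subtype.ext (ActsBy.left_unique hD hDe h h')
      rfl
    · intro B
      obtain ⟨A, hA, h⟩ := exists_mem_actsBy hD B
      exact ⟨⟨(⟨A, hA⟩, B), h⟩, rfl⟩
  refine ⟨(AlgEquiv.ofBijective f hf).symm.trans (AlgEquiv.ofBijective g hg), fun A => ?_⟩
  obtain ⟨p, rfl⟩ := (AlgEquiv.ofBijective f hf).surjective A
  rw [AlgEquiv.trans_apply, AlgEquiv.symm_apply_apply]
  exact p.2

end FoldedCube

end

theorem mainTheorem4 (D : ℕ) (hD : 3 < D) (hDeven : Even D) :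
    ∃ Φ : FoldedCube.terwilligerAlgebra (FoldedCube.graph (2 * D)) (FoldedCube.origin (2 * D)) ≃ₐ[ℂ]
        (∀ r : Fin (D + 1), Matrix (FoldedCube.levels D r) (FoldedCube.levels D r) ℂ),
      ∀ (ι : Fin (D + 1) → Type*) [∀ r, Fintype (ι r)] [∀ r, DecidableEq (ι r)]
        (b : ∀ r : Fin (D + 1), OrthonormalBasis (ι r) ℂ (FoldedCube.lowestSpace D r)),
        (FoldedCube.transition D b)ᴴ * FoldedCube.transition D b = 1 ∧
        FoldedCube.transition D b * (FoldedCube.transition D b)ᴴ = 1 ∧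
        ∀ A : FoldedCube.terwilligerAlgebra (FoldedCube.graph (2 * D))
            (FoldedCube.origin (2 * D)),
          (FoldedCube.transition D b)ᴴ * (A : Matrix (FoldedCube.Vertex (2 * D)) (FoldedCube.Vertex (2 * D)) ℂ) *
              FoldedCube.transition D b =
            Matrix.blockDiagonal' fun r : Fin (D + 1) =>
              (1 : Matrix (ι r) (ι r) ℂ) ⊗ₖ Φ A r := by
  have hD2 : 2 ≤ D := by omega
  obtain ⟨Φ, hΦ⟩ := FoldedCube.exists_algEquiv hD2 hDeven
  refine ⟨Φ, fun ι _ _ b => ⟨FoldedCube.transition_conjTranspose_mul_self b hD2,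
    FoldedCube.transition_mul_conjTranspose b hD2 hDeven, fun A => ?_⟩⟩
  exact (hΦ A).transition_conj hD2 b
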